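/- Let $B=\bigoplus_{\alpha\in\mathbb Z}\mathbb C[\partial]L_\alpha$ be the Lie conformal algebra with $\lambda$-bracket $[L_\alpha{}_\lambda L_\beta]=(\alpha\partial+(\alpha+\beta)\lambda)L_{\alpha+\beta}$, graded by $B_\alpha=\mathbb C[\partial]L_\alpha$. A conformal $B$-module is a $\mathbb C[\partial]$-module $V$ with a $\mathbb C$-bilinear $\lambda$-action $B\times V\to V[\lambda]$, $(a,v)\mapsto a_\lambda v$, such that $[a_\lambda b]_{\lambda+\mu}v=a_\lambda(b_\mu v)-b_\mu(a_\lambda v)$, $(\partial a)_\lambda v=-\lambda\, a_\lambda v$ and $a_\lambda(\partial v)=(\partial+\lambda)a_\lambda v$ for all $a,b\in B$, $v\in V$. It is nontrivial if $a_\lambda v\neq 0$ for some $a,v$. It is a free intermediate series module if $V=\bigoplus_{\gamma\in\mathbb Z}V_\gamma$ as a $\mathbb C[\partial]$-module, where $(B_\alpha)_\lambda V_\gamma\subseteq V_{\alpha+\gamma}[\lambda]$ for all $\alpha,\gamma\in\mathbb Z$ and each $V_\gamma$ is freely generated by one element over $\mathbb C[\partial]$. An isomorphism of $B$-modules is a $\mathbb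 C[\partial]$-linear bijection commuting with the $\lambda$-actions; it need not preserve gradings. For $C,D\in\mathbb C$, define $\lambda$-actions on $\bigoplus_{\gamma\in\mathbb Z}\mathbb C[\partial]v_\gamma$, with $\{v_\gamma\}$ a $\mathbb C[\partial]$-basis, by the following formulas on basis elements, extended by the last two module axioms above: $V_{C,D}$: $\quad L_\alpha{}_\lambda v_\gamma=\big((\alpha+\gamma+C)\lambda+\alpha(\partial+D)\big)v_{\alpha+\gamma}$; $V_D$: $\quad L_\alpha{}_\lambda v_\gamma=\begin{cases}\big((\alpha+\gamma)\lambda+\alpha(\partial+D)\big)v_{\alpha+\gamma}&\text{if }\gamma\ne0\text{ and }\alpha+\gamma\neq0,\\ \alpha(\lambda+\partial+D)^2v_{\alpha+\gamma}&\text{if }\gamma=0,\\ \alpha v_{\alpha+\gamma}&\text{if }\alpha+\gamma=0;\end{cases}$ $V'_D$: $\quad L_\alpha{}_\lambda v_\gamma=\begin{cases}\big((\alpha+\gamma)\lambda+\alpha(\partial+D)\big)v_{\alpha+\gamma}&\text{if }\gamma\ne0\text{ and }\alpha+\gamma\neq0,\\ \alpha v_{\alpha+\gamma}&\text{if }\gamma=0,\\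 \alpha(\partial+D)^2v_{\alpha+\gamma}&\text{if }\alpha+\gamma=0.\end{cases}$ (If $\gamma=\alpha+\gamma=0$, both special formulas give $0$.) **Theorem.** All $V_{C,D}$, $V_D$, $V'_D$ with $C,D\in\mathbb C$ are nontrivial free intermediate series $B$-modules. Every nontrivial free intermediate series $B$-module is isomorphic to $V_{C,D}$ for some $C,D\in\mathbb C$, or to $V_D$ for some $D\in\mathbb C$, or to $V'_D$ for some $D\in\mathbb C$. Moreover $V_{C,D}\cong V_{C+n,D}$ for all $C,D\in\mathbb C$ and $n\in\mathbb Z$. -/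

import Mathlib

open Polynomial

/-
Conventions.  `ℂ[X]` is the polynomial ring `ℂ[∂]`, so `X • v` is `∂ v`.
A formal power series `∑ₙ λⁿ wₙ` in `V[[λ]]` is the sequence of its coefficients `n ↦ wₙ`,
that is, an element of `ℕ → V`.
-/

namespace BlockConformal

noncomputable section

section General

variable (R V W : Type*)
  [AddCommGroup R] [Module ℂ R] [Module ℂ[X] R] [IsScalarTower ℂ ℂ[X] R]
  [AddCommGroup V] [Module ℂ V] [Module ℂ[X] V] [IsScalarTower ℂ ℂ[X] V]
  [AddCommGroup W] [Module ℂ W] [Module ℂ[X] W] [IsScalarTower ℂ ℂ[X] W]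

/-- A `ℂ`-bilinear `λ`-product `R × V → V[[λ]]`, `(a, v) ↦ a_λ v`; the element `act a v n` of `V`
is the coefficient of `λⁿ` in `a_λ v`. -/
abbrev LambdaProduct := R →ₗ[ℂ] V →ₗ[ℂ] (ℕ → V)

variable {R V W}

/-- Multiplication of a power series in `V[[λ]]` by `λ`. -/
def mulLam (w : ℕ → V) : ℕ → V
  | 0 => 0
  | n + 1 => w n

/-- `V` with the `λ`-action `act` is a module over `R` with the `λ`-bracket `br`. -/
structure IsLambdaModule (br : LambdaProduct R R) (act : LambdaProduct R V) : Prop where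
  /-- `[a_λ b]_{λ+μ} v = a_λ (b_μ v) - b_μ (a_λ v)` in `V[[λ, μ]]`, at the monomial `λ^m μ^n`:
  on the left, the summand `λ^i (λ+μ)^(j+n) ([a_λ b]_i)_(j+n) v` with `i + j = m` contributes
  with the binomial coefficient `(j+n).choose n`. -/
  jacobi : ∀ (a b : R) (v : V) (m n : ℕ),
    ∑ ij ∈ Finset.HasAntidiagonal.antidiagonal m,
        (ij.2 + n).choose n • act (br a b ij.1) v (ij.2 + n) =
      act a (act b v n) m - act b (act a v m) n
  /-- `(∂ a)_λ v = - λ (a_λ v)`. -/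
  del_left : ∀ (a : R) (v : V), act ((X : ℂ[X]) • a) v = -mulLam (act a v)
  /-- `a_λ (∂ v) = (∂ + λ) (a_λ v)`. -/
  del_right : ∀ (a : R) (v : V),
    act a ((X : ℂ[X]) • v) = (X : ℂ[X]) • act a v + mulLam (act a v)

/-- The module is conformal: `a_λ v` lies in `V[λ]` for all `a` and `v`. -/
def IsConformal (act : LambdaProduct R V) : Prop :=
  ∀ (a : R) (v : V), ∃ N : ℕ, ∀ n : ℕ, N ≤ n → act a v n = 0

/-- All `λ`-actions vanish. -/
def IsTrivialAction (act : LambdaProduct R V) : Prop :=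
  ∀ (a : R) (v : V), act a v = 0

/-- A family `𝒱` of `ℂ[∂]`-submodules makes `V` a `ℤ`-graded module over `R`, which is graded by
`𝓡`: `V = ⨁ 𝒱_γ` and `(𝓡_α)_λ 𝒱_γ ⊆ 𝒱_{α+γ}[[λ]]`. -/
def IsGrading (𝓡 : ℤ → Submodule ℂ[X] R) (act : LambdaProduct R V)
    (𝒱 : ℤ → Submodule ℂ[X] V) : Prop :=
  DirectSum.IsInternal 𝒱 ∧
    ∀ (α γ : ℤ), ∀ a ∈ 𝓡 α, ∀ v ∈ 𝒱 γ, ∀ n : ℕ, act a v n ∈ 𝒱 (α + γ)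

/-- The submodule `S` is freely generated by one element over `ℂ[∂]`. -/
def IsFreeOfRankOne (S : Submodule ℂ[X] V) : Prop :=
  ∃ v : V, Submodule.span ℂ[X] {v} = S ∧ ∀ p : ℂ[X], p • v = 0 → p = 0

/-- Free intermediate series modules: conformal `ℤ`-graded modules, every homogeneous component
of which is freely generated by one element over `ℂ[∂]`. -/
def IsFreeIntermediateSeries (br : LambdaProduct R R) (𝓡 : ℤ → Submodule ℂ[X] R)
    (act : LambdaProduct R V) : Prop :=
  IsLambdaModule br act ∧ IsConformal act ∧
    ∃ 𝒱 : ℤ → Submodule ℂ[X] V, IsGrading 𝓡 act 𝒱 ∧ ∀ γ : ℤ, IsFreeOfRankOne (𝒱 γ)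

/-- Isomorphism of modules over `R`: a `ℂ[∂]`-linear bijection that commutes with the
`λ`-actions (it need not preserve any grading). -/
def ModuleIso (act : LambdaProduct R V) (act' : LambdaProduct R W) : Prop :=
  ∃ φ : V ≃ₗ[ℂ[X]] W, ∀ (a : R) (v : V) (n : ℕ), φ (act a v n) = act' a (φ v) n

end General

/-! ### The ring of polynomials in two variables -/

/-- The variable `λ` of `ℂ[λ, ∂] = ℂ[∂][λ]`. -/
def lam : ℂ[X][X] := X

/-- The variable `∂` of `ℂ[λ, ∂] = ℂ[∂][λ]`. -/
def del : ℂ[X][X] := C X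

/-- The constant `c` of `ℂ[λ, ∂] = ℂ[∂][λ]`. -/
def const (c : ℂ) : ℂ[X][X] := C (C c)

/-! ### The products with given structure coefficients -/

/-- The free `ℂ[∂]`-module `⨁ ℂ[∂] e_γ` on a basis indexed by `ℤ`. -/
abbrev FreeZ := ℤ →₀ ℂ[X]

/-- The basis element with index `γ`. -/
def basisElt (γ : ℤ) : FreeZ := Finsupp.single γ 1

/-- The `λ`-product with `(e_α)_λ e_γ = f_{α,γ}(λ, ∂) e_{α+γ}` on basis elements, extended
by `(∂ a)_λ v = - λ (a_λ v)` and `a_λ (∂ v) = (∂ + λ) (a_λ v)`, that is,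
`(p(∂) e_α)_λ (q(∂) e_γ) = p(-λ) q(∂ + λ) f_{α,γ}(λ, ∂) e_{α+γ}`. -/
def productOfCoeffs (f : ℤ → ℤ → ℂ[X][X]) : LambdaProduct FreeZ FreeZ :=
  LinearMap.mk₂ ℂ
    (fun a v n => a.sum fun α p => v.sum fun γ q =>
      Finsupp.single (α + γ) ((aeval (-lam) p * aeval (del + lam) q * f α γ).coeff n))
    (by
      intro a a' v
      funext n
      refine Finsupp.sum_add_index' ?_ ?_
      · intro α; simp
      · intro α p p'
        simp [add_mul, Finsupp.sum_add])
    (by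
      intro c a v
      funext n
      simp only [Pi.smul_apply]
      rw [Finsupp.sum_smul_index' (by intro α; simp), Finsupp.smul_sum]
      refine Finsupp.sum_congr fun α _ => ?_
      rw [Finsupp.smul_sum]
      refine Finsupp.sum_congr fun γ _ => ?_
      simp)
    (by
      intro a v v'
      funext n
      simp only [Pi.add_apply]
      rw [← Finsupp.sum_add]
      refine Finsupp.sum_congr fun α _ => ?_
      refine Finsupp.sum_add_index' ?_ ?_
      · intro γ; simp
      · intro γ q q'
        simp [add_mul, mul_add])
    (by
      intro c a v
      funext n
      simp only [Pi.smul_apply]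
      rw [Finsupp.smul_sum]
      refine Finsupp.sum_congr fun α _ => ?_
      rw [Finsupp.sum_smul_index' (by intro γ; simp), Finsupp.smul_sum]
      refine Finsupp.sum_congr fun γ _ => ?_
      simp)

/-! ### The Lie conformal algebra `B` -/

/-- `B = ⨁ ℂ[∂] L_α`. -/
abbrev B := FreeZ

/-- The `λ`-bracket `[L_α _λ L_β] = (α ∂ + (α + β) λ) L_{α+β}` of `B`. -/
def bracketB : LambdaProduct B B :=
  productOfCoeffs fun α β => const α * del + const (α + β) * lam

/-- The homogeneous component `B_α = ℂ[∂] L_α`. -/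
def gradingB (α : ℤ) : Submodule ℂ[X] B := Submodule.span ℂ[X] {basisElt α}

/-! ### The three families -/

/-- `V_{c,d}`: `(L_α)_λ v_γ = ((α + γ + c) λ + α (∂ + d)) v_{α+γ}`. -/
def actV (c d : ℂ) : LambdaProduct B FreeZ :=
  productOfCoeffs fun α γ => const (α + γ + c) * lam + const α * (del + const d)

/-- `V_d`: `(L_α)_λ v_γ` is `α (λ + ∂ + d)² v_{α+γ}` for `γ = 0`, `α v_{α+γ}` for `α + γ = 0`,
and `((α + γ) λ + α (∂ + d)) v_{α+γ}` otherwise.  (For `γ = 0` and `α + γ = 0` both of the first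
two formulas are `0`.) -/
def actVD (d : ℂ) : LambdaProduct B FreeZ :=
  productOfCoeffs fun α γ =>
    if γ = 0 then const α * (lam + del + const d) ^ 2
    else if α + γ = 0 then const α
    else const (α + γ) * lam + const α * (del + const d)

/-- `V'_d`: `(L_α)_λ v_γ` is `α v_{α+γ}` for `γ = 0`, `α (∂ + d)² v_{α+γ}` for `α + γ = 0`,
and `((α + γ) λ + α (∂ + d)) v_{α+γ}` otherwise.  (For `γ = 0` and `α + γ = 0` both of the first
two formulas are `0`.) -/
def actVDPrime (d : ℂ) : LambdaProduct B FreeZ :=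
  productOfCoeffs fun α γ =>
    if γ = 0 then const α
    else if α + γ = 0 then const α * (del + const d) ^ 2
    else const (α + γ) * lam + const α * (del + const d)

/-- Nontrivial free intermediate series modules over `B`. -/
def IsNontrivialFreeIntermediateSeries {V : Type*} [AddCommGroup V] [Module ℂ V]
    [Module ℂ[X] V] [IsScalarTower ℂ ℂ[X] V] (act : LambdaProduct B V) : Prop :=
  IsFreeIntermediateSeries bracketB gradingB act ∧ ¬ IsTrivialAction act

end

end BlockConformal

open BlockConformal

namespace BlockConformal

/-! ### Polynomials in two and three variables -/

/-! Generators of the components encode a module in structure coefficients `f α γ` in `ℂ[∂][λ]`, and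
the Jacobi identity becomes the functional equation `JacobiCoeffs`. The classification is read off
from specialisations of that equation.

The action of `L_0` controls everything. Since `L_0` commutes with itself, `f 0 γ` is a polynomial
`φ_γ(λ)` free of `∂` (`evalEval_eq_of_commute`). The relation with `L_β` forces `φ_{β+γ} = φ_γ + βλ`
whenever `f β γ ≠ 0` (`WeightEq.target_eq`), and a single nonzero `φ_γ` makes enough coefficients
nonzero to link all components (`JacobiCoeffs.ne_zero`). A difference equation for the value of `f β
γ` at `λ = 0` then gives `φ_γ = (γ + c)λ` (`JacobiCoeffs.exists_degree`) and makes `f β γ` linear in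
`λ` and `∂` between components of nonzero degree `γ + c`. The leading coefficients form a cocycle,
which a rescaling of the basis removes (`HasDegree.exists_monic`); the constant terms are then `βD`
for one number `D` (`JacobiCoeffs.exists_constant_term`).

If `c` is not an integer, this is `V_{c,D}`. Otherwise a shift makes `c = 0`, and only the component
`0` is still undetermined: the coefficients out of it are `β p(∂ + λ)`, those into it `β q(∂)`, and
`p q = (∂ + D)²` (`JacobiCoeffs.exists_mul_eq_sq`). So `p` is a scalar times `(∂ + D)^i` with `i =
0, 1, 2`, and rescaling `v_0` yields `V'_D`, `V_{0,D}`, `V_D` respectively. -/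

theorem eq_of_evalEval_eq {p q : ℂ[X][X]} (h : ∀ l x : ℂ, evalEval x l p = evalEval x l q) :
    p = q := by
  refine eq_of_infinite_eval_eq p q ?_
  refine (Set.infinite_range_of_injective (C_injective (R := ℂ))).mono ?_
  rintro _ ⟨l, rfl⟩
  exact Polynomial.funext fun x => h l x

theorem eq_of_eval_eval_eval_eq {p q : ℂ[X][X][X]}
    (h : ∀ l m x : ℂ, evalEval x l (eval (C (C m)) p) = evalEval x l (eval (C (C m)) q)) :
    p = q := by
  refine eq_of_infinite_eval_eq p q ?_
  refine (Set.infinite_range_of_injective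
    ((C_injective (R := ℂ[X])).comp (C_injective (R := ℂ)))).mono ?_
  rintro _ ⟨m, rfl⟩
  exact eq_of_evalEval_eq fun l x => h l m x

@[simp]
theorem evalEval_lam (l x : ℂ) : evalEval x l lam = l := by simp [lam]

@[simp]
theorem evalEval_del (l x : ℂ) : evalEval x l del = x := by
  rw [del, evalEval_C, eval_X]

@[simp]
theorem evalEval_const (l x c : ℂ) : evalEval x l (const c) = c := by simp [const]

theorem evalEval_aeval (l x : ℂ) (s : ℂ[X][X]) (p : ℂ[X]) :
    evalEval x l (aeval s p) = eval (evalEval x l s) p := by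
  induction p using Polynomial.induction_on' with
  | add p q hp hq => simp only [map_add, evalEval_add, hp, hq, eval_add]
  | monomial n a =>
    rw [aeval_monomial, evalEval_mul, evalEval_pow, eval_monomial]
    congr 1
    change evalEval x l (C (C a)) = a
    simp

@[simp]
theorem evalEval_aeval_neg_lam (l x : ℂ) (p : ℂ[X]) :
    evalEval x l (aeval (-lam) p) = eval (-l) p := by
  rw [evalEval_aeval, evalEval_neg, evalEval_lam]

@[simp]
theorem evalEval_aeval_del_add_lam (l x : ℂ) (p : ℂ[X]) :
    evalEval x l (aeval (del + lam) p) = eval (x + l) p := by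
  rw [evalEval_aeval, evalEval_add, evalEval_lam, evalEval_del]

/-- The coefficients of `S(λ, ∂) U(μ, ∂ + λ) T(λ, ∂)` as a polynomial in `μ` and `λ`. -/
theorem exists_coeff_shift (S U T : ℂ[X][X]) : ∃ Q : ℂ[X][X][X],
    (∀ m n, (Q.coeff n).coeff m = (S * aeval (del + lam) (U.coeff n) * T).coeff m) ∧
    ∀ l m x : ℂ, evalEval x l (eval (C (C m)) Q) =
      evalEval x l S * evalEval (x + l) m U * evalEval x l T := by
  refine ⟨C S * U.map (aeval (R := ℂ) (del + lam)).toRingHom * C T, fun m n => ?_,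
    fun l m x => ?_⟩
  · rw [coeff_mul_C, coeff_C_mul, coeff_map]; rfl
  · simp only [eval_mul, eval_C, evalEval_mul]
    congr 2
    induction U using Polynomial.induction_on' with
    | add p q hp hq => simp only [Polynomial.map_add, eval_add, evalEval_add, hp, hq]
    | monomial n a =>
      rw [map_monomial, eval_monomial]
      simp only [evalEval, eval_monomial, eval_mul, eval_pow, eval_C]
      congr 1
      exact evalEval_aeval_del_add_lam l x a

theorem coeff_coeff_swap {R : Type*} [CommRing R] (p : R[X][X]) (m n : ℕ) :
    ((Bivariate.swap p).coeff n).coeff m = (p.coeff m).coeff n := by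
  induction p using Polynomial.induction_on' with
  | add p q hp hq => simp only [map_add, coeff_add, hp, hq]
  | monomial i a =>
    induction a using Polynomial.induction_on' with
    | add p q hp hq => simp only [map_add, coeff_add, hp, hq]
    | monomial k a =>
      rw [Bivariate.swap_monomial_monomial]
      by_cases hi : i = m <;> by_cases hk : k = n <;> simp [coeff_monomial, hi, hk]

/-- The coefficients of `S(μ, ∂) U(λ, ∂ + μ) T(μ, ∂)` as a polynomial in `μ` and `λ`. -/
theorem exists_coeff_shift_swap (S U T : ℂ[X][X]) : ∃ Q : ℂ[X][X][X],
    (∀ m n, (Q.coeff n).coeff m = (S * aeval (del + lam) (U.coeff m) * T).coeff n) ∧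
    ∀ l m x : ℂ, evalEval x l (eval (C (C m)) Q) =
      evalEval x m S * evalEval (x + m) l U * evalEval x m T := by
  obtain ⟨Q, hQ, hQ'⟩ := exists_coeff_shift S U T
  refine ⟨Bivariate.swap Q, fun m n => ?_, fun l m x => ?_⟩
  · rw [coeff_coeff_swap, hQ]
  · rw [← hQ']
    have h := Bivariate.aevalAeval_swap (C l) (C m) Q
    rw [coe_aevalAeval_eq_evalEval, coe_aevalAeval_eq_evalEval] at h
    exact congrArg (eval x) h

/-- Expanding `U(λ + μ)` produces the binomial coefficients that appear in `IsLambdaModule.jacobi`.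
-/
theorem coeff_coeff_taylor_X {R : Type*} [CommRing R] (U : R[X]) (j n : ℕ) :
    ((taylor X (U.map C)).coeff n).coeff j = (j + n).choose n • U.coeff (j + n) := by
  have h : hasseDeriv n (U.map C) = (hasseDeriv n U).map C := by
    ext k : 1
    simp [hasseDeriv_coeff, coeff_map]
  rw [taylor_coeff, h, eval_map, eval₂_C_X, hasseDeriv_coeff, nsmul_eq_mul]

/-- The coefficients of `W(λ, -λ - μ) T(λ + μ, ∂)` as a polynomial in `μ` and `λ`. -/
theorem exists_coeff_taylor (W T : ℂ[X][X]) : ∃ Q : ℂ[X][X][X],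
    (∀ m n, (Q.coeff n).coeff m = ∑ ij ∈ Finset.HasAntidiagonal.antidiagonal m,
      (ij.2 + n).choose n • (aeval (-lam) (W.coeff ij.1) * T).coeff (ij.2 + n)) ∧
    ∀ l m x : ℂ, evalEval x l (eval (C (C m)) Q) =
      evalEval (-(l + m)) l W * evalEval x (l + m) T := by
  induction W using Polynomial.induction_on' with
  | add p q hp hq =>
    obtain ⟨Q₁, h₁, h₁'⟩ := hp
    obtain ⟨Q₂, h₂, h₂'⟩ := hq
    refine ⟨Q₁ + Q₂, fun m n => ?_, fun l m x => ?_⟩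
    · simp only [coeff_add, h₁, h₂, map_add, add_mul, smul_add, Finset.sum_add_distrib]
    · simp only [eval_add, evalEval_add, h₁', h₂', add_mul]
  | monomial i a =>
    set U : ℂ[X][X] := aeval (-lam) a * T with hU
    refine ⟨C (X ^ i) * taylor X (U.map C), fun m n => ?_, fun l m x => ?_⟩
    · rw [coeff_C_mul, coeff_X_pow_mul', coeff_coeff_taylor_X]
      have hc : ∀ ij : ℕ × ℕ, (ij.2 + n).choose n •
          (aeval (-lam) ((monomial i a).coeff ij.1) * T).coeff (ij.2 + n) =
          if ij.1 = i then (ij.2 + n).choose n • U.coeff (ij.2 + n) else 0 := by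
        intro ij
        rw [coeff_monomial]
        by_cases h : i = ij.1
        · rw [if_pos h, if_pos h.symm]
        · rw [if_neg h, if_neg (Ne.symm h)]; simp
      simp_rw [hc]
      rw [Finset.Nat.sum_antidiagonal_eq_sum_range_succ_mk, Finset.sum_ite_eq']
      simp
    · have h : evalEval x l (eval (C (C m)) (taylor X (U.map C))) = evalEval x (l + m) U := by
        rw [taylor_eval, eval_map, ← comp, evalEval, eval_comp]
        simp [evalEval, add_comm]
      rw [eval_mul, evalEval_mul, h, hU, evalEval_mul, evalEval_aeval_neg_lam]
      simp [evalEval]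
      ring

/-! ### Products with given structure coefficients -/

theorem productOfCoeffs_single (f : ℤ → ℤ → ℂ[X][X]) (α γ : ℤ) (p q : ℂ[X]) (n : ℕ) :
    productOfCoeffs f (Finsupp.single α p) (Finsupp.single γ q) n =
      Finsupp.single (α + γ) ((aeval (-lam) p * aeval (del + lam) q * f α γ).coeff n) := by
  rw [productOfCoeffs, LinearMap.mk₂_apply]
  simp

/-- The Jacobi identity for the structure coefficients of a `λ`-action of `B`. -/
def JacobiCoeffs (f : ℤ → ℤ → ℂ[X][X]) : Prop :=
  ∀ (α β γ : ℤ) (l m x : ℂ),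
    (β * l - α * m) * evalEval x (l + m) (f (α + β) γ) =
      evalEval x l (f α (β + γ)) * evalEval (x + l) m (f β γ) -
        evalEval x m (f β (α + γ)) * evalEval (x + m) l (f α γ)

/-- Sesquilinearity only contributes the common factor `p(-λ) q(-μ) r(∂ + λ + μ)`. With `p = q = r =
1` this extracts `JacobiCoeffs` from a module; for general `p`, `q`, `r` it gives back the identity
on all homogeneous elements. -/
theorem productOfCoeffs_jacobi_single_iff (f : ℤ → ℤ → ℂ[X][X]) (α β γ : ℤ) (p q r : ℂ[X]) :
    (∀ m n : ℕ, ∑ ij ∈ Finset.HasAntidiagonal.antidiagonal m,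
        (ij.2 + n).choose n • productOfCoeffs f
          (bracketB (Finsupp.single α p) (Finsupp.single β q) ij.1)
          (Finsupp.single γ r) (ij.2 + n) =
      productOfCoeffs f (Finsupp.single α p)
          (productOfCoeffs f (Finsupp.single β q) (Finsupp.single γ r) n) m -
        productOfCoeffs f (Finsupp.single β q)
          (productOfCoeffs f (Finsupp.single α p) (Finsupp.single γ r) m) n) ↔
    ∀ l m x : ℂ, eval (-l) p * eval (-m) q * eval (x + l + m) r *
      ((β * l - α * m) * evalEval x (l + m) (f (α + β) γ)) =
      eval (-l) p * eval (-m) q * eval (x + l + m) r *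
      (evalEval x l (f α (β + γ)) * evalEval (x + l) m (f β γ) -
        evalEval x m (f β (α + γ)) * evalEval (x + m) l (f α γ)) := by
  obtain ⟨Q₁, h₁, h₁'⟩ := exists_coeff_taylor
    (aeval (-lam) p * aeval (del + lam) q * (const α * del + const (α + β) * lam))
    (aeval (del + lam) r * f (α + β) γ)
  obtain ⟨Q₂, h₂, h₂'⟩ := exists_coeff_shift (aeval (-lam) p)
    (aeval (-lam) q * aeval (del + lam) r * f β γ) (f α (β + γ))
  obtain ⟨Q₃, h₃, h₃'⟩ := exists_coeff_shift_swap (aeval (-lam) q)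
    (aeval (-lam) p * aeval (del + lam) r * f α γ) (f β (α + γ))
  -- All three terms live in the component `α + β + γ`, so the identity compares coefficients of
  -- polynomials in three variables; these are equal exactly when their values agree at all complex
  -- points.
  have hL : ∀ m n : ℕ, ∑ ij ∈ Finset.HasAntidiagonal.antidiagonal m,
        (ij.2 + n).choose n • productOfCoeffs f
          (bracketB (Finsupp.single α p) (Finsupp.single β q) ij.1)
          (Finsupp.single γ r) (ij.2 + n) =
      Finsupp.single (α + β + γ) ((Q₁.coeff n).coeff m) := by
    intro m n
    rw [h₁]
    simp only [bracketB, productOfCoeffs_single, Finsupp.smul_single, mul_assoc]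
    rw [← Finsupp.singleAddHom_apply, map_sum]
    simp only [Finsupp.singleAddHom_apply]
  have hR : ∀ m n : ℕ, productOfCoeffs f (Finsupp.single α p)
          (productOfCoeffs f (Finsupp.single β q) (Finsupp.single γ r) n) m -
        productOfCoeffs f (Finsupp.single β q)
          (productOfCoeffs f (Finsupp.single α p) (Finsupp.single γ r) m) n =
      Finsupp.single (α + β + γ) (((Q₂ - Q₃).coeff n).coeff m) := by
    intro m n
    rw [coeff_sub, coeff_sub, h₂, h₃]
    simp only [productOfCoeffs_single]
    rw [← add_assoc, ← add_assoc, add_comm β α, Finsupp.single_sub]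
  simp only [hL, hR, (Finsupp.single_injective _).eq_iff]
  have hev : (∀ l m x : ℂ, eval (-l) p * eval (-m) q * eval (x + l + m) r *
      ((β * l - α * m) * evalEval x (l + m) (f (α + β) γ)) =
      eval (-l) p * eval (-m) q * eval (x + l + m) r *
      (evalEval x l (f α (β + γ)) * evalEval (x + l) m (f β γ) -
        evalEval x m (f β (α + γ)) * evalEval (x + m) l (f α γ))) ↔
      ∀ l m x : ℂ, evalEval x l (eval (C (C m)) Q₁) = evalEval x l (eval (C (C m)) (Q₂ - Q₃)) := by
    refine forall_congr' fun l => forall_congr' fun m => forall_congr' fun x => ?_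
    rw [h₁', eval_sub, evalEval_sub, h₂', h₃']
    simp only [evalEval_mul, evalEval_add, evalEval_aeval_neg_lam, evalEval_aeval_del_add_lam,
      evalEval_const, evalEval_del, evalEval_lam]
    have e₁ : -(l + m) + l = -m := by ring
    have e₂ : x + (l + m) = x + l + m := by ring
    have e₃ : x + m + l = x + l + m := by ring
    rw [e₁, e₂, e₃]
    constructor
    · intro h; linear_combination h
    · intro h; linear_combination h
  rw [hev]
  constructor
  · intro h l m x
    have : Q₁ = Q₂ - Q₃ := by
      ext n m : 2
      exact h m n
    rw [this]
  · intro h m n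
    rw [eq_of_eval_eval_eval_eq h]

theorem productOfCoeffs_del_left (f : ℤ → ℤ → ℂ[X][X]) (a v : FreeZ) :
    productOfCoeffs f ((X : ℂ[X]) • a) v = -mulLam (productOfCoeffs f a v) := by
  funext n
  induction a using Finsupp.induction_linear with
  | zero => cases n <;> simp [mulLam]
  | add a b ha hb =>
    rw [smul_add, map_add, map_add, LinearMap.add_apply, LinearMap.add_apply, Pi.add_apply, ha, hb]
    cases n <;> simp [mulLam, add_comm]
  | single α p =>
    induction v using Finsupp.induction_linear with
    | zero => cases n <;> simp [mulLam]
    | add a b ha hb =>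
      rw [map_add, map_add, Pi.add_apply, ha, hb]
      cases n <;> simp [mulLam, add_comm]
    | single γ q =>
      have e : aeval (-lam) (X * p) * aeval (del + lam) q * f α γ =
          -(X * (aeval (-lam) p * aeval (del + lam) q * f α γ)) := by
        rw [map_mul, aeval_X, lam]; ring
      rw [Finsupp.smul_single, productOfCoeffs_single, smul_eq_mul, e, coeff_neg]
      cases n with
      | zero => simp [mulLam]
      | succ n => simp [mulLam, productOfCoeffs_single, Finsupp.single_neg]

theorem productOfCoeffs_del_right (f : ℤ → ℤ → ℂ[X][X]) (a v : FreeZ) :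
    productOfCoeffs f a ((X : ℂ[X]) • v) =
      (X : ℂ[X]) • productOfCoeffs f a v + mulLam (productOfCoeffs f a v) := by
  funext n
  induction a using Finsupp.induction_linear with
  | zero => cases n <;> simp [mulLam]
  | add a b ha hb =>
    rw [map_add, LinearMap.add_apply, LinearMap.add_apply, Pi.add_apply, ha, hb]
    cases n <;> (simp [mulLam]; try abel)
  | single α p =>
    induction v using Finsupp.induction_linear with
    | zero => cases n <;> simp [mulLam]
    | add a b ha hb =>
      rw [smul_add, map_add, map_add, Pi.add_apply, ha, hb]
      cases n <;> (simp [mulLam]; try abel)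
    | single γ q =>
      have e : aeval (-lam) p * aeval (del + lam) (X * q) * f α γ =
          C X * (aeval (-lam) p * aeval (del + lam) q * f α γ) +
          X * (aeval (-lam) p * aeval (del + lam) q * f α γ) := by
        rw [map_mul, aeval_X, lam, del]; ring
      rw [Finsupp.smul_single, productOfCoeffs_single, smul_eq_mul, e, coeff_add, coeff_C_mul,
        Finsupp.single_add, Pi.add_apply, Pi.smul_apply, productOfCoeffs_single,
        Finsupp.smul_single, smul_eq_mul]
      cases n with
      | zero => simp [mulLam]
      | succ n => simp [mulLam, productOfCoeffs_single]

theorem isLambdaModule_productOfCoeffs_iff (f : ℤ → ℤ → ℂ[X][X]) :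
    IsLambdaModule bracketB (productOfCoeffs f) ↔ JacobiCoeffs f := by
  constructor
  · intro h α β γ l m x
    have := (productOfCoeffs_jacobi_single_iff f α β γ 1 1 1).1
      (fun m n => h.jacobi _ _ _ m n) l m x
    simpa using this
  · intro h
    refine ⟨fun a b v m n => ?_, productOfCoeffs_del_left f, productOfCoeffs_del_right f⟩
    induction a using Finsupp.induction_linear with
    | zero => simp
    | add a a' ha ha' =>
      simp only [map_add, LinearMap.add_apply, Pi.add_apply, smul_add, Finset.sum_add_distrib,
        ha, ha']
      abel
    | single α p =>
      induction b using Finsupp.induction_linear with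
      | zero => simp
      | add b b' hb hb' =>
        simp only [map_add, LinearMap.add_apply, Pi.add_apply, smul_add, Finset.sum_add_distrib,
          hb, hb']
        abel
      | single β q =>
        induction v using Finsupp.induction_linear with
        | zero => simp
        | add v v' hv hv' =>
          simp only [map_add, Pi.add_apply, smul_add, Finset.sum_add_distrib, hv, hv']
          abel
        | single γ r =>
          exact (productOfCoeffs_jacobi_single_iff f α β γ p q r).2
            (fun l m x => by rw [h]) m n

/-! ### Modules with given structure coefficients -/

theorem ModuleIso.trans {V W U : Type*} [AddCommGroup V] [Module ℂ V] [Module ℂ[X] V]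
    [AddCommGroup W] [Module ℂ W] [Module ℂ[X] W] [AddCommGroup U] [Module ℂ U] [Module ℂ[X] U]
    {act : LambdaProduct B V} {act' : LambdaProduct B W} {act'' : LambdaProduct B U}
    (h : ModuleIso act act') (h' : ModuleIso act' act'') : ModuleIso act act'' := by
  obtain ⟨φ, hφ⟩ := h
  obtain ⟨ψ, hψ⟩ := h'
  exact ⟨φ.trans ψ, fun a v n => by simp [hφ, hψ]⟩

theorem map_mulLam {V W : Type*} [AddCommGroup V] [Module ℂ[X] V] [AddCommGroup W]
    [Module ℂ[X] W] (φ : V →ₗ[ℂ[X]] W) (w : ℕ → V) (n : ℕ) :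
    φ (mulLam w n) = mulLam (fun k => φ (w k)) n := by
  cases n <;> simp [mulLam]

/-! ### Checking that a map is a module homomorphism on basis elements. -/

section Intertwining

variable {V W : Type*}
  [AddCommGroup V] [Module ℂ V] [Module ℂ[X] V] [IsScalarTower ℂ ℂ[X] V]
  [AddCommGroup W] [Module ℂ W] [Module ℂ[X] W] [IsScalarTower ℂ ℂ[X] W]

theorem intertwines_smul_left {act : LambdaProduct B V} {act' : LambdaProduct B W}
    (h : ∀ a v, act ((X : ℂ[X]) • a) v = -mulLam (act a v))
    (h' : ∀ a v, act' ((X : ℂ[X]) • a) v = -mulLam (act' a v))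
    (φ : V →ₗ[ℂ[X]] W) {a : B} {v : V} (hav : ∀ n, φ (act a v n) = act' a (φ v) n) (p : ℂ[X]) :
    ∀ n, φ (act (p • a) v n) = act' (p • a) (φ v) n := by
  induction p using Polynomial.induction_on with
  | C c =>
    intro n
    have : (C c : ℂ[X]) • a = c • a := algebraMap_smul ℂ[X] c a
    rw [this, map_smul, map_smul, LinearMap.smul_apply, LinearMap.smul_apply, Pi.smul_apply,
      Pi.smul_apply, LinearMap.map_smul_of_tower, hav]
  | add p q hp hq =>
    intro n
    simp only [add_smul, map_add, LinearMap.add_apply, Pi.add_apply, hp, hq]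
  | monomial k c hk =>
    intro n
    have e : (C c * X ^ (k + 1) : ℂ[X]) • a = (X : ℂ[X]) • ((C c * X ^ k : ℂ[X]) • a) := by
      rw [smul_smul]; congr 1; ring
    rw [e, h, h', Pi.neg_apply, Pi.neg_apply, map_neg, map_mulLam]
    simp only [hk]

theorem intertwines_smul_right {act : LambdaProduct B V} {act' : LambdaProduct B W}
    (h : ∀ a v, act a ((X : ℂ[X]) • v) = (X : ℂ[X]) • act a v + mulLam (act a v))
    (h' : ∀ a v, act' a ((X : ℂ[X]) • v) = (X : ℂ[X]) • act' a v + mulLam (act' a v))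
    (φ : V →ₗ[ℂ[X]] W) {a : B} {v : V} (hav : ∀ n, φ (act a v n) = act' a (φ v) n) (p : ℂ[X]) :
    ∀ n, φ (act a (p • v) n) = act' a (φ (p • v)) n := by
  induction p using Polynomial.induction_on with
  | C c =>
    intro n
    have : (C c : ℂ[X]) • v = c • v := algebraMap_smul ℂ[X] c v
    rw [this, map_smul, LinearMap.map_smul_of_tower, map_smul, Pi.smul_apply, Pi.smul_apply,
      LinearMap.map_smul_of_tower, hav]
  | add p q hp hq =>
    intro n
    simp only [add_smul, map_add, Pi.add_apply, hp, hq]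
  | monomial k c hk =>
    intro n
    have e : (C c * X ^ (k + 1) : ℂ[X]) • v = (X : ℂ[X]) • ((C c * X ^ k : ℂ[X]) • v) := by
      rw [smul_smul]; congr 1; ring
    rw [e, h, map_smul φ X, h', Pi.add_apply, Pi.add_apply, Pi.smul_apply, Pi.smul_apply,
      map_add, map_smul, map_mulLam]
    simp only [hk]

/-- A `ℂ[∂]`-linear map intertwines two sesquilinear actions of `B` as soon as it does so on
basis elements. -/
theorem intertwines_of_basis {act : LambdaProduct B V} {act' : LambdaProduct B W}
    (hl : ∀ a v, act ((X : ℂ[X]) • a) v = -mulLam (act a v))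
    (hl' : ∀ a v, act' ((X : ℂ[X]) • a) v = -mulLam (act' a v))
    (hr : ∀ a v, act a ((X : ℂ[X]) • v) = (X : ℂ[X]) • act a v + mulLam (act a v))
    (hr' : ∀ a v, act' a ((X : ℂ[X]) • v) = (X : ℂ[X]) • act' a v + mulLam (act' a v))
    (φ : V →ₗ[ℂ[X]] W) (b : Module.Basis ℤ ℂ[X] V)
    (h : ∀ α γ n, φ (act (basisElt α) (b γ) n) = act' (basisElt α) (φ (b γ)) n)
    (a : B) (v : V) (n : ℕ) : φ (act a v n) = act' a (φ v) n := by
  induction a using Finsupp.induction_linear generalizing n with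
  | zero => simp
  | add a a' ha ha' => simp only [map_add, LinearMap.add_apply, Pi.add_apply, ha, ha']
  | single α p =>
    have hp : Finsupp.single α p = p • basisElt α := by simp [basisElt]
    rw [hp]
    refine intertwines_smul_left hl hl' φ (fun n => ?_) p n
    induction b.mem_span v using Submodule.span_induction generalizing n with
    | zero => simp
    | add v v' _ _ hv hv' => simp only [map_add, Pi.add_apply, hv, hv']
    | smul q v _ hv => exact intertwines_smul_right hr hr' φ hv q n
    | mem v hv =>
      obtain ⟨γ, rfl⟩ := hv
      exact h α γ n

end Intertwining

/-- Rescaling the basis elements and shifting their indices. -/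
theorem moduleIso_of_coeffs (f f' : ℤ → ℤ → ℂ[X][X]) (n : ℤ) (κ : ℤ → ℂ) (hκ : ∀ γ, κ γ ≠ 0)
    (h : ∀ (α γ : ℤ) (l x : ℂ), κ (α + γ) * evalEval x l (f α γ) =
      κ γ * evalEval x l (f' α (γ + n))) :
    ModuleIso (productOfCoeffs f) (productOfCoeffs f') := by
  have hu : ∀ γ, IsUnit (C (κ γ) : ℂ[X]) := fun γ => isUnit_C.2 (isUnit_iff_ne_zero.2 (hκ γ))
  let b : Module.Basis ℤ ℂ[X] FreeZ := Finsupp.basisSingleOne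
  -- The map `e_γ ↦ κ_γ e_{γ+n}`.
  let φ : FreeZ ≃ₗ[ℂ[X]] FreeZ :=
    b.equiv ((b.reindex (Equiv.subRight n)).unitsSMul fun γ => (hu γ).unit) (Equiv.refl ℤ)
  have hφ : ∀ γ q, φ (Finsupp.single γ q) = Finsupp.single (γ + n) (C (κ γ) * q) := by
    intro γ q
    have h1 : φ (b γ) = Finsupp.single (γ + n) (C (κ γ)) := by
      simp only [φ, Module.Basis.equiv_apply, Module.Basis.unitsSMul_apply]
      simp [b, Units.smul_def]
    have h2 : Finsupp.single γ q = q • b γ := by simp [b]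
    rw [h2, map_smul, h1, Finsupp.smul_single, smul_eq_mul, mul_comm]
  refine ⟨φ, intertwines_of_basis (productOfCoeffs_del_left f) (productOfCoeffs_del_left f')
    (productOfCoeffs_del_right f) (productOfCoeffs_del_right f') φ.toLinearMap b ?_⟩
  intro α γ k
  have hb : b γ = Finsupp.single γ 1 := by simp [b]
  have e : C (C (κ (α + γ))) * f α γ = C (C (κ γ)) * f' α (γ + n) := by
    refine eq_of_evalEval_eq fun l x => ?_
    rw [evalEval_mul, evalEval_mul, evalEval_CC, evalEval_CC, h]
  rw [LinearEquiv.coe_coe, hb, basisElt, hφ, productOfCoeffs_single, productOfCoeffs_single, hφ,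
    ← add_assoc]
  congr 1
  have e' := congrArg (fun p => p.coeff k) e
  simp only [coeff_C_mul] at e'
  rw [map_one, one_mul, map_one, one_mul, e', mul_one, aeval_C, one_mul]
  rw [show algebraMap ℂ ℂ[X][X] (κ γ) = C (C (κ γ)) from rfl, coeff_C_mul]

/-! ### Passing between graded modules and structure coefficients. -/

theorem gradingB_eq_range (γ : ℤ) :
    gradingB γ = LinearMap.range (Finsupp.lsingle (R := ℂ[X]) (M := ℂ[X]) γ) := by
  rw [gradingB]
  ext v
  simp only [Submodule.mem_span_singleton, LinearMap.mem_range, Finsupp.lsingle_apply, basisElt,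
    Finsupp.smul_single, smul_eq_mul, mul_one]

theorem isInternal_gradingB : DirectSum.IsInternal gradingB := by
  have h : gradingB = fun γ => Submodule.span ℂ[X]
      {(Finsupp.basisSingleOne : Module.Basis ℤ ℂ[X] FreeZ) γ} := by
    funext γ
    simp [gradingB, basisElt]
  rw [DirectSum.isInternal_submodule_iff_iSupIndep_and_iSup_eq_top, h,
    ← Submodule.span_range_eq_iSup, Module.Basis.span_eq]
  exact ⟨(Module.Basis.linearIndependent _).iSupIndep_span_singleton, rfl⟩

theorem isFreeIntermediateSeries_productOfCoeffs {f : ℤ → ℤ → ℂ[X][X]} (hf : JacobiCoeffs f) :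
    IsFreeIntermediateSeries bracketB gradingB (productOfCoeffs f) := by
  refine ⟨(isLambdaModule_productOfCoeffs_iff f).2 hf, ?_, gradingB,
    ⟨isInternal_gradingB, ?_⟩, fun γ => ⟨basisElt γ, rfl, fun p hp => ?_⟩⟩
  · intro a v
    induction a using Finsupp.induction_linear with
    | zero => exact ⟨0, by simp⟩
    | add a a' ha ha' =>
      obtain ⟨N, hN⟩ := ha
      obtain ⟨N', hN'⟩ := ha'
      refine ⟨max N N', fun n hn => ?_⟩
      rw [map_add, LinearMap.add_apply, Pi.add_apply, hN n (le_of_max_le_left hn),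
        hN' n (le_of_max_le_right hn), add_zero]
    | single α p =>
      induction v using Finsupp.induction_linear with
      | zero => exact ⟨0, by simp⟩
      | add v v' hv hv' =>
        obtain ⟨N, hN⟩ := hv
        obtain ⟨N', hN'⟩ := hv'
        refine ⟨max N N', fun n hn => ?_⟩
        rw [map_add, Pi.add_apply, hN n (le_of_max_le_left hn),
          hN' n (le_of_max_le_right hn), add_zero]
      | single γ q =>
        refine ⟨(aeval (-lam) p * aeval (del + lam) q * f α γ).natDegree + 1, fun n hn => ?_⟩
        rw [productOfCoeffs_single, coeff_eq_zero_of_natDegree_lt hn, Finsupp.single_zero]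
  · intro α γ a ha v hv n
    rw [gradingB_eq_range, LinearMap.mem_range] at ha hv ⊢
    obtain ⟨p, rfl⟩ := ha
    obtain ⟨q, rfl⟩ := hv
    rw [Finsupp.lsingle_apply, Finsupp.lsingle_apply, productOfCoeffs_single]
    exact ⟨_, rfl⟩
  · simpa [basisElt] using hp

theorem not_isTrivialAction_productOfCoeffs {f : ℤ → ℤ → ℂ[X][X]} {α γ : ℤ} (h : f α γ ≠ 0) :
    ¬ IsTrivialAction (productOfCoeffs f) := by
  intro ht
  refine h (Polynomial.ext fun n => ?_)
  have := congrFun (ht (basisElt α) (basisElt γ)) n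
  rw [basisElt, basisElt, productOfCoeffs_single] at this
  simpa using this

theorem isTrivialAction_productOfCoeffs_zero {f : ℤ → ℤ → ℂ[X][X]} (h : ∀ α γ, f α γ = 0) :
    IsTrivialAction (productOfCoeffs f) := by
  intro a v
  funext n
  induction a using Finsupp.induction_linear with
  | zero => simp
  | add a a' ha ha' => simp [ha, ha']
  | single α p =>
    induction v using Finsupp.induction_linear with
    | zero => simp
    | add v v' hv hv' => simp [hv, hv']
    | single γ q => rw [productOfCoeffs_single, h]; simp

/-- A free intermediate series module is given by structure coefficients. -/
theorem exists_coeffs {V : Type*} [AddCommGroup V] [Module ℂ V] [Module ℂ[X] V]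
    [IsScalarTower ℂ ℂ[X] V] {act : LambdaProduct B V}
    (hact : IsNontrivialFreeIntermediateSeries act) :
    ∃ f : ℤ → ℤ → ℂ[X][X], JacobiCoeffs f ∧ (∃ α γ, f α γ ≠ 0) ∧
      ModuleIso act (productOfCoeffs f) := by
  obtain ⟨⟨hmod, hconf, 𝒱, ⟨hint, hgr⟩, hfree⟩, hnt⟩ := hact
  choose u hspan hu using hfree
  have humem : ∀ γ, u γ ∈ 𝒱 γ := fun γ => hspan γ ▸ Submodule.mem_span_singleton_self _
  have hb : ∃ b : Module.Basis ℤ ℂ[X] V, ∀ γ, b γ = u γ := by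
    let v : ∀ γ, Module.Basis Unit ℂ[X] (𝒱 γ) := fun γ =>
      Module.Basis.mk (v := fun _ => ⟨u γ, humem γ⟩)
        (by
          refine linearIndependent_iff.2 fun c hc => ?_
          rw [Finsupp.linearCombination_unique] at hc
          ext : 1
          exact hu γ _ (congrArg Subtype.val hc))
        (by
          rintro ⟨w, hw⟩ -
          rw [← hspan, Submodule.mem_span_singleton] at hw
          obtain ⟨q, rfl⟩ := hw
          exact Submodule.smul_mem _ q (Submodule.subset_span (Set.mem_range_self ())))
    refine ⟨(hint.collectedBasis v).reindex (Equiv.sigmaPUnit ℤ), fun γ => ?_⟩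
    simp [v]
  obtain ⟨b, hb⟩ := hb
  have hcoef : ∀ α γ, ∃ p : ℂ[X][X], ∀ n,
      act (basisElt α) (b γ) n = p.coeff n • b (α + γ) := by
    intro α γ
    have h1 : ∀ n, ∃ q : ℂ[X], q • u (α + γ) = act (basisElt α) (b γ) n := by
      intro n
      rw [← Submodule.mem_span_singleton, hspan]
      exact hgr α γ _ (Submodule.mem_span_singleton_self _) _ (hb γ ▸ humem γ) n
    choose q hq using h1
    -- Conformality makes the sequence of coefficients finite, hence a polynomial in `λ`.
    obtain ⟨N, hN⟩ := hconf (basisElt α) (b γ)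
    refine ⟨∑ n ∈ Finset.range N, monomial n (q n), fun n => ?_⟩
    rw [finsetSum_coeff]
    simp only [coeff_monomial, Finset.sum_ite_eq', Finset.mem_range]
    split_ifs with h
    · rw [hb (α + γ), hq]
    · rw [hN n (not_lt.1 h), zero_smul]
  choose f hf using hcoef
  have hiso : ∀ a v n, b.repr (act a v n) = productOfCoeffs f a (b.repr v) n := by
    refine intertwines_of_basis hmod.del_left (productOfCoeffs_del_left f) hmod.del_right
      (productOfCoeffs_del_right f) b.repr.toLinearMap b fun α γ n => ?_
    rw [LinearEquiv.coe_coe, hf, map_smul, Module.Basis.repr_self, Module.Basis.repr_self,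
      basisElt, productOfCoeffs_single]
    simp
  have hiso' : ∀ a w n, act a (b.repr.symm w) n = b.repr.symm (productOfCoeffs f a w n) := by
    intro a w n
    rw [LinearEquiv.eq_symm_apply, hiso, LinearEquiv.apply_symm_apply]
  refine ⟨f, (isLambdaModule_productOfCoeffs_iff f).1 ⟨fun a b' w m n => ?_,
    productOfCoeffs_del_left f, productOfCoeffs_del_right f⟩, ?_, b.repr, hiso⟩
  · have := congrArg b.repr (hmod.jacobi a b' (b.repr.symm w) m n)
    simpa only [map_sum, map_nsmul, map_sub, hiso, LinearEquiv.apply_symm_apply] using this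
  · by_contra! h0
    refine hnt fun a v => funext fun n => ?_
    apply b.repr.injective
    rw [hiso, isTrivialAction_productOfCoeffs_zero h0]
    simp

/-! ### The action of `L_0` -/

theorem eval_map_evalRingHom (F : ℂ[X][X]) (l x : ℂ) :
    eval l (F.map (evalRingHom x)) = evalEval x l F := by
  rw [eval_map, eval₂_evalRingHom]

theorem coeff_taylor_of_natDegree_le {G : ℂ[X]} {N : ℕ} (h : G.natDegree ≤ N) (r : ℂ) :
    (taylor r G).coeff N = G.coeff N := by
  rcases h.eq_or_lt with rfl | h
  · rw [coeff_taylor_natDegree, leadingCoeff]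
  · rw [coeff_eq_zero_of_natDegree_lt h, coeff_eq_zero_of_natDegree_lt (by rwa [natDegree_taylor])]

/-- Fix `l` and `x₀` and compare degrees in `m` in `g(l, x₀) g(m, x₀ + l) = g(m, x₀) g(l, x₀ + m)`.
The left side has degree at most `deg_λ g`; the right side has this degree plus the degree of `g(l,
·)`, which must therefore be constant. -/
theorem evalEval_eq_of_commute {g : ℂ[X][X]}
    (hg : ∀ l m x : ℂ, evalEval x l g * evalEval (x + l) m g =
      evalEval x m g * evalEval (x + m) l g) (l x : ℂ) :
    evalEval x l g = evalEval 0 l g := by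
  by_cases hg0 : g = 0
  · simp [hg0]
  -- The point `x₀` is chosen so that specialising `∂` there does not lower the degree in `λ`.
  obtain ⟨x₀, hx₀⟩ : ∃ x₀, eval x₀ g.leadingCoeff ≠ 0 := by
    by_contra! h
    exact hg0 (leadingCoeff_eq_zero.1 (Polynomial.funext fun r => by rw [h, eval_zero]))
  set A : ℂ[X] := eval (C l) g with hA
  have key : C (eval x₀ A) * g.map (evalRingHom (x₀ + l)) =
      g.map (evalRingHom x₀) * taylor x₀ A := by
    refine Polynomial.funext fun m => ?_
    rw [eval_mul, eval_mul, eval_C, eval_map_evalRingHom, eval_map_evalRingHom, taylor_eval,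
      add_comm m]
    exact hg l m x₀
  have hdeg : (g.map (evalRingHom x₀)).natDegree = g.natDegree :=
    natDegree_map_of_leadingCoeff_ne_zero _ hx₀
  have hne : g.map (evalRingHom x₀) ≠ 0 := by
    intro h
    apply hx₀
    have := congrArg (fun p => p.coeff g.natDegree) h
    simpa [coeff_map] using this
  have hA0 : A.natDegree = 0 := by
    by_cases h : A = 0
    · rw [h, natDegree_zero]
    · have h1 := congrArg natDegree key
      rw [natDegree_mul hne (by rwa [Ne, taylor_eq_zero]), hdeg, natDegree_taylor] at h1
      have h2 := natDegree_C_mul_le (eval x₀ A) (g.map (evalRingHom (x₀ + l)))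
      have h3 := natDegree_map_le (f := evalRingHom (x₀ + l)) (p := g)
      omega
  change eval x A = eval 0 A
  rw [eq_C_of_natDegree_eq_zero hA0, eval_C, eval_C]

theorem JacobiCoeffs.exists_weight {f : ℤ → ℤ → ℂ[X][X]} (hf : JacobiCoeffs f) :
    ∃ φ : ℤ → ℂ[X], ∀ γ l x, evalEval x l (f 0 γ) = eval l (φ γ) := by
  refine ⟨fun γ => (f 0 γ).map (evalRingHom 0), fun γ l x => ?_⟩
  rw [eval_map_evalRingHom]
  refine evalEval_eq_of_commute (fun l m x => ?_) l x
  have := hf 0 0 γ l m x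
  simp only [Int.cast_zero, zero_mul, sub_self, zero_add] at this
  exact sub_eq_zero.1 this.symm

/-- The condition imposed on a structure coefficient `F` of `L_β` by the commutation relation
with `L_0`, which acts as `φ(λ)` on the source and as `φ'(λ)` on the target. -/
def WeightEq (β : ℂ) (φ φ' : ℂ[X]) (F : ℂ[X][X]) : Prop :=
  ∀ l m x : ℂ, β * l * evalEval x (l + m) F =
    eval l φ' * evalEval (x + l) m F - eval l φ * evalEval x m F

theorem JacobiCoeffs.weightEq {f : ℤ → ℤ → ℂ[X][X]} (hf : JacobiCoeffs f) {φ : ℤ → ℂ[X]}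
    (hφ : ∀ γ l x, evalEval x l (f 0 γ) = eval l (φ γ)) (β γ : ℤ) :
    WeightEq β (φ γ) (φ (β + γ)) (f β γ) := by
  intro l m x
  have := hf 0 β γ l m x
  rw [hφ, hφ, zero_add, zero_add, Int.cast_zero] at this
  linear_combination this

/-- Both `m ↦ l + m` and `x ↦ x + l` preserve top coefficients, so comparing the top coefficient in
`m` and then in `x` replaces all values of `F` by one nonzero number. -/
theorem WeightEq.target_eq {β : ℂ} {φ φ' : ℂ[X]} {F : ℂ[X][X]} (h : WeightEq β φ φ' F)
    (hF : F ≠ 0) (l : ℂ) : eval l φ' = eval l φ + β * l := by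
  have h1 : ∀ x, β * l * eval x F.leadingCoeff =
      eval l φ' * eval (x + l) F.leadingCoeff - eval l φ * eval x F.leadingCoeff := by
    intro x
    have e : C (β * l) * taylor l (F.map (evalRingHom x)) =
        C (eval l φ') * F.map (evalRingHom (x + l)) - C (eval l φ) * F.map (evalRingHom x) := by
      refine Polynomial.funext fun m => ?_
      simp only [eval_mul, eval_sub, eval_C, eval_map_evalRingHom, taylor_eval]
      rw [add_comm m]
      exact h l m x
    have e' := congrArg (fun p => p.coeff F.natDegree) e
    simp only [coeff_C_mul, coeff_sub, coeff_taylor_of_natDegree_le natDegree_map_le,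
      coeff_map, coe_evalRingHom] at e'
    exact e'
  have e : C (β * l) * F.leadingCoeff =
      C (eval l φ') * taylor l F.leadingCoeff - C (eval l φ) * F.leadingCoeff := by
    refine Polynomial.funext fun x => ?_
    simp only [eval_mul, eval_sub, eval_C, taylor_eval]
    exact h1 x
  have e' := congrArg (fun p => p.coeff F.leadingCoeff.natDegree) e
  simp only [coeff_C_mul, coeff_sub, coeff_taylor_natDegree, coeff_natDegree] at e'
  have h0 : F.leadingCoeff.leadingCoeff ≠ 0 :=
    leadingCoeff_ne_zero.2 (leadingCoeff_ne_zero.2 hF)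
  refine mul_right_cancel₀ h0 ?_
  linear_combination -e'

/-- The polynomial `F(-λ, ∂ + λ)`. -/
theorem exists_evalEval_twist (F : ℂ[X][X]) :
    ∃ T : ℂ[X][X], ∀ l x : ℂ, evalEval x l T = evalEval (x + l) (-l) F := by
  refine ⟨eval₂ (aeval (R := ℂ) (del + lam)).toRingHom (-lam) F, fun l x => ?_⟩
  induction F using Polynomial.induction_on' with
  | add p q hp hq => simp only [eval₂_add, evalEval_add, hp, hq]
  | monomial n a =>
    rw [eval₂_monomial, evalEval_mul, evalEval_pow, evalEval_neg, evalEval_lam]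
    simp only [evalEval, eval_monomial, eval_mul, eval_pow, eval_C]
    congr 1
    exact evalEval_aeval_del_add_lam l x a

/-- If `L_0` acts nontrivially on the component `γ`, all structure coefficients out of and into
this component are nonzero. -/
theorem JacobiCoeffs.ne_zero {f : ℤ → ℤ → ℂ[X][X]} (hf : JacobiCoeffs f) {φ : ℤ → ℂ[X]}
    (hφ : ∀ γ l x, evalEval x l (f 0 γ) = eval l (φ γ)) {γ : ℤ} (hγ : φ γ ≠ 0) {β : ℤ}
    (hβ : β ≠ 0) : f (-β) γ ≠ 0 ∧ f β (-β + γ) ≠ 0 := by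
  by_contra hcon
  have hzero : ∀ l m x : ℂ, evalEval x m (f β (-β + γ)) * evalEval (x + m) l (f (-β) γ) = 0 := by
    intro l m x
    by_cases h : f (-β) γ = 0
    · simp [h]
    · have h' : f β (-β + γ) = 0 := by
        by_contra h'
        exact hcon ⟨h, h'⟩
      simp [h']
  have hJ : ∀ l m x : ℂ, β * (l + m) * eval (l + m) (φ γ) =
      evalEval x l (f (-β) (β + γ)) * evalEval (x + l) m (f β γ) := by
    intro l m x
    have := hf (-β) β γ l m x
    rw [hzero, neg_add_cancel, hφ, sub_zero] at this
    rw [← this]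
    push_cast
    ring
  -- With one product in the Jacobi identity gone, the other equals a multiple of `(l + m) φ_γ(l +
  -- m)`, which vanishes at `m = -l`. There it is a product of two polynomials in `l` and `x`, so
  -- one factor is zero, and then so is `φ_γ`.
  obtain ⟨T, hT⟩ := exists_evalEval_twist (f β γ)
  have hprod : f (-β) (β + γ) * T = 0 := by
    refine eq_of_evalEval_eq fun l x => ?_
    rw [evalEval_mul, hT, ← hJ]
    simp
  have hrhs : ∀ l m x, evalEval x l (f (-β) (β + γ)) * evalEval (x + l) m (f β γ) = 0 := by
    intro l m x
    rcases mul_eq_zero.1 hprod with h | h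
    · simp [h]
    · have := hT (-m) (x + l + m)
      rw [h, evalEval_zero, neg_neg, add_neg_cancel_right] at this
      rw [← this, mul_zero]
  apply hγ
  have hX : X * φ γ = 0 := by
    refine Polynomial.funext fun l => ?_
    have := hJ l 0 0
    rw [hrhs, add_zero, mul_assoc] at this
    rw [eval_mul, eval_X, eval_zero]
    exact (mul_eq_zero.1 this).resolve_left (Int.cast_ne_zero.2 hβ)
  exact (mul_eq_zero.1 hX).resolve_left X_ne_zero

theorem JacobiCoeffs.weight_eq {f : ℤ → ℤ → ℂ[X][X]} (hf : JacobiCoeffs f) {φ : ℤ → ℂ[X]}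
    (hφ : ∀ γ l x, evalEval x l (f 0 γ) = eval l (φ γ)) {γ : ℤ} (hγ : φ γ ≠ 0) (γ' : ℤ) (l : ℂ) :
    eval l (φ γ') = eval l (φ γ) + (γ' - γ) * l := by
  by_cases h : γ' = γ
  · simp [h]
  · have h1 := (hf.ne_zero hφ hγ (β := γ - γ') (sub_ne_zero.2 (Ne.symm h))).1
    have h2 := (hf.weightEq hφ (-(γ - γ')) γ).target_eq h1 l
    rw [show -(γ - γ') + γ = γ' by ring] at h2
    rw [h2]
    push_cast
    ring

/-- If `L_0` acted as zero, a nonzero coefficient of `L_β` would force `β = 0` by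
`WeightEq.target_eq`, contradicting the vanishing of `L_0`. -/
theorem JacobiCoeffs.exists_weight_ne_zero {f : ℤ → ℤ → ℂ[X][X]} (hf : JacobiCoeffs f)
    {φ : ℤ → ℂ[X]} (hφ : ∀ γ l x, evalEval x l (f 0 γ) = eval l (φ γ))
    (hne : ∃ α γ, f α γ ≠ 0) : ∃ γ, φ γ ≠ 0 := by
  by_contra! h
  obtain ⟨β, γ, hβγ⟩ := hne
  have h1 := (hf.weightEq hφ β γ).target_eq hβγ 1
  rw [h, h, eval_zero, zero_add, mul_one] at h1
  have hβ : β = 0 := by exact_mod_cast h1.symm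
  subst hβ
  exact hβγ (eq_of_evalEval_eq fun l x => by rw [hφ, h, eval_zero, evalEval_zero])

/-! ### Structure coefficients at `λ = 0` -/

theorem evalEval_zero_right (F : ℂ[X][X]) (x : ℂ) : evalEval x 0 F = eval x (F.coeff 0) := by
  rw [evalEval, C_0, ← coeff_zero_eq_eval_zero]

theorem natDegree_iterate_derivative_eq (P : ℂ[X]) (k : ℕ) :
    (derivative^[k] P).natDegree = P.natDegree - k := by
  induction k with
  | zero => simp
  | succ k hk => rw [Function.iterate_succ_apply', natDegree_derivative, hk, Nat.sub_sub]

/-- A relation between translates of `P` whose coefficients do not depend on `x` is inherited by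
every derivative of `P`. Differentiating thus lowers the degree of `P` to any smaller value without
losing the relation. -/
theorem sum_eval_iterate_derivative_eq_zero {ι : Type*} (s : Finset ι) (c r : ι → ℂ) {P : ℂ[X]}
    (h : ∀ x, ∑ i ∈ s, c i * eval (x + r i) P = 0) (k : ℕ) (x : ℂ) :
    ∑ i ∈ s, c i * eval (x + r i) (derivative^[k] P) = 0 := by
  induction k generalizing x with
  | zero => exact h x
  | succ k hk =>
    have e : ∑ i ∈ s, C (c i) * (derivative^[k] P).comp (X + C (r i)) = 0 := by
      refine Polynomial.funext fun x => ?_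
      simpa [eval_finsetSum, eval_comp] using hk x
    have e' := congrArg (fun q => eval x (derivative q)) e
    simpa [derivative_comp, eval_finsetSum, eval_comp, Function.iterate_succ_apply'] using e'

/-- The condition on `F(0, ∂)` that results from eliminating the other coefficients of `F`. -/
theorem WeightEq.eval_iterate_derivative {β : ℂ} {φ φ' : ℂ[X]} {F : ℂ[X][X]}
    (h : WeightEq β φ φ' F) (k : ℕ) (l m x : ℂ) :
    let P := derivative^[k] (F.coeff 0)
    β * l * m * (eval (l + m) φ' * eval (x + l + m) P - eval (l + m) φ * eval x P) =
      (l + m) * (eval l φ' * (eval m φ' * eval (x + l + m) P - eval m φ * eval (x + l) P) -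
        eval l φ * (eval m φ' * eval (x + m) P - eval m φ * eval x P)) := by
  intro P
  have hF : ∀ l x, β * l * evalEval x l F =
      eval l φ' * eval (x + l) (F.coeff 0) - eval l φ * eval x (F.coeff 0) := by
    intro l x
    have := h l 0 x
    rwa [add_zero, evalEval_zero_right, evalEval_zero_right] at this
  -- `F(l + m, x)` is computed in two ways: directly from `F(0, ∂)`, and through `F(m, ∂)`, which is
  -- itself expressed by `F(0, ∂)`.
  have h0 : ∀ x, ∑ i : Fin 4, ![β * l * m * eval (l + m) φ' - (l + m) * eval l φ' * eval m φ',
      -(β * l * m * eval (l + m) φ) - (l + m) * eval l φ * eval m φ,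
      (l + m) * eval l φ' * eval m φ, (l + m) * eval l φ * eval m φ'] i *
      eval (x + ![l + m, 0, l, m] i) (F.coeff 0) = 0 := by
    intro x
    have e₁ := h l m x
    have e₂ := hF (l + m) x
    have e₃ := hF m (x + l)
    have e₄ := hF m x
    simp only [Fin.sum_univ_four, Matrix.cons_val]
    rw [add_assoc] at e₃
    rw [add_zero]
    linear_combination β * m * (l + m) * e₁ - β * l * m * e₂ + (l + m) * eval l φ' * e₃ -
      (l + m) * eval l φ * e₄
  have h1 := sum_eval_iterate_derivative_eq_zero _ _ _ h0 k x
  simp only [Fin.sum_univ_four, Matrix.cons_val, add_zero] at h1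
  rw [add_assoc x l m]
  linear_combination h1

theorem exists_eq_linear_of_natDegree_eq_one {P : ℂ[X]} (h : P.natDegree = 1) :
    ∃ p q : ℂ, p ≠ 0 ∧ ∀ x, eval x P = p * x + q := by
  refine ⟨P.coeff 1, P.coeff 0, ?_, fun x => ?_⟩
  · rw [← h, coeff_natDegree, Ne, leadingCoeff_eq_zero]
    rintro rfl
    simp at h
  · rw [eval_eq_sum_range, h, Finset.sum_range_succ, Finset.sum_range_one]
    ring

theorem exists_eq_quadratic_of_natDegree_eq_two {P : ℂ[X]} (h : P.natDegree = 2) :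
    ∃ p q r : ℂ, p ≠ 0 ∧ ∀ x, eval x P = p * x ^ 2 + q * x + r := by
  refine ⟨P.coeff 2, P.coeff 1, P.coeff 0, ?_, fun x => ?_⟩
  · rw [← h, coeff_natDegree, Ne, leadingCoeff_eq_zero]
    rintro rfl
    simp at h
  · rw [eval_eq_sum_range, h, Finset.sum_range_succ, Finset.sum_range_succ, Finset.sum_range_one]
    ring

/-- The coefficient of degree `n` is killed by `2 ^ n - 2`, which vanishes only for `n = 1`. -/
theorem eq_linear_of_eval_two_mul {φ : ℂ[X]} (h : ∀ l, l ≠ 0 → eval (2 * l) φ = 2 * eval l φ) :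
    ∀ l, eval l φ = φ.coeff 1 * l := by
  have e : φ.comp (C 2 * X) = C 2 * φ := by
    refine eq_of_infinite_eval_eq _ _ ((Set.finite_singleton (0 : ℂ)).infinite_compl.mono ?_)
    intro l hl
    simpa using h l hl
  have hφ : φ = C (φ.coeff 1) * X := by
    ext n
    rw [coeff_C_mul, coeff_X]
    by_cases hn : 1 = n
    · simp [hn]
    · rw [if_neg hn, mul_zero]
      have e' := congrArg (fun q => q.coeff n) e
      simp only [comp_C_mul_X_coeff, coeff_C_mul] at e'
      have h2 : (2 : ℂ) ^ n - 2 ≠ 0 := by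
        intro h2
        have h3 : (2 : ℂ) ^ n = 2 ^ 1 := by linear_combination h2
        have h4 : 2 ^ n = 2 ^ 1 := by exact_mod_cast h3
        exact hn (Nat.pow_right_injective le_rfl h4).symm
      refine (mul_eq_zero.1 (?_ : ((2 : ℂ) ^ n - 2) * φ.coeff n = 0)).resolve_left h2
      linear_combination e'
  intro l
  conv_lhs => rw [hφ]
  simp

/-- If `F` depends on `∂`, then `φ` is linear. -/
theorem WeightEq.weight_linear {β : ℂ} (hβ : β ≠ 0) {φ φ' : ℂ[X]} {F : ℂ[X][X]}
    (h : WeightEq β φ φ' F) (hP : (F.coeff 0).natDegree ≠ 0) (l : ℂ) :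
    eval l φ = φ.coeff 1 * l := by
  have hF : F ≠ 0 := by
    rintro rfl
    simp at hP
  have hφ' := h.target_eq hF
  -- Differentiating down to degree one and setting `l = m`, `x = 0` leaves `2 β l³ p (φ(2l) - 2
  -- φ(l)) = 0`.
  obtain ⟨p, q, hp, hpq⟩ := exists_eq_linear_of_natDegree_eq_one
    (P := derivative^[(F.coeff 0).natDegree - 1] (F.coeff 0))
    (by rw [natDegree_iterate_derivative_eq]; omega)
  refine eq_linear_of_eval_two_mul (fun l hl => ?_) l
  have := h.eval_iterate_derivative ((F.coeff 0).natDegree - 1) l l 0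
  simp only [hpq, hφ'] at this
  have hne : 2 * β * l ^ 3 * p ≠ 0 := by simp [hβ, hl, hp]
  refine mul_left_cancel₀ hne ?_
  rw [two_mul l]
  linear_combination this

/-- If `c` and `c'` are nonzero, then `F` has degree at most one. -/
theorem WeightEq.natDegree_le_one {β c c' : ℂ} {φ φ' : ℂ[X]} {F : ℂ[X][X]}
    (h : WeightEq β φ φ' F) (hφ : ∀ l, eval l φ = c * l) (hφ' : ∀ l, eval l φ' = c' * l)
    (hβ : c' = c + β) (hc : c ≠ 0) (hc' : c' ≠ 0) : (F.coeff 0).natDegree ≤ 1 := by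
  by_contra! hdeg
  obtain ⟨p, q, r, hp, hpq⟩ := exists_eq_quadratic_of_natDegree_eq_two
    (P := derivative^[(F.coeff 0).natDegree - 2] (F.coeff 0))
    (by rw [natDegree_iterate_derivative_eq]; omega)
  have := h.eval_iterate_derivative ((F.coeff 0).natDegree - 2) 1 1 0
  simp only [hpq, hφ, hφ'] at this
  have hz : c * c' * p = 0 := by
    subst hβ
    linear_combination -this / 4
  simp [hc, hc', hp] at hz

theorem WeightEq.evalEval_eq {β c c' : ℂ} {φ φ' : ℂ[X]} {F : ℂ[X][X]}
    (h : WeightEq β φ φ' F) (hφ : ∀ l, eval l φ = c * l) (hφ' : ∀ l, eval l φ' = c' * l)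
    (hβ : c' = c + β) (l x : ℂ) :
    β * evalEval x l F = c' * eval (x + l) (F.coeff 0) - c * eval x (F.coeff 0) := by
  by_cases hl : l = 0
  · subst hl
    rw [evalEval_zero_right, hβ, add_zero]
    ring
  · have := h l 0 x
    rw [hφ, hφ', evalEval_zero_right, evalEval_zero_right, add_zero] at this
    refine mul_left_cancel₀ hl ?_
    linear_combination this

theorem WeightEq.exists_eq_linear {β c c' : ℂ} {φ φ' : ℂ[X]} {F : ℂ[X][X]}
    (h : WeightEq β φ φ' F) (hφ : ∀ l, eval l φ = c * l) (hφ' : ∀ l, eval l φ' = c' * l)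
    (hβ : c' = c + β) (hc : c ≠ 0) (hc' : c' ≠ 0) (hβ0 : β ≠ 0) :
    ∃ k d : ℂ, ∀ l x, evalEval x l F = k * (c' * l + β * x) + d := by
  obtain ⟨p, q, hpq⟩ := exists_eq_X_add_C_of_natDegree_le_one
    (h.natDegree_le_one hφ hφ' hβ hc hc')
  refine ⟨p / β, q, fun l x => ?_⟩
  have := h.evalEval_eq hφ hφ' hβ l x
  rw [hpq] at this
  simp only [eval_add, eval_mul, eval_C, eval_X] at this
  refine mul_left_cancel₀ hβ0 ?_
  rw [this]
  field_simp
  rw [hβ]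
  ring

theorem JacobiCoeffs.exists_degree {f : ℤ → ℤ → ℂ[X][X]} (hf : JacobiCoeffs f)
    (hne : ∃ α γ, f α γ ≠ 0) :
    ∃ c : ℂ, ∀ γ l x, evalEval x l (f 0 γ) = (γ + c) * l := by
  obtain ⟨φ, hφ⟩ := hf.exists_weight
  obtain ⟨γ, hγ⟩ := hf.exists_weight_ne_zero hφ hne
  have hφγ := hf.weight_eq hφ hγ
  -- If no weight were linear, all coefficients of `L_β` with `β ≠ 0` would be constants. The Jacobi
  -- identity for `L_{-1}` and `L_1` would then make `l φ_γ(l)` constant, forcing `φ_γ = 0`.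
  obtain ⟨γ₀, c₀, hlin⟩ : ∃ (γ₀ : ℤ) (c₀ : ℂ), ∀ l, eval l (φ γ₀) = c₀ * l := by
    by_contra! hcon
    have hdeg : ∀ β γ : ℤ, β ≠ 0 → ((f β γ).coeff 0).natDegree = 0 := by
      intro β γ' hβ
      by_contra hd
      obtain ⟨l, hl⟩ := hcon γ' ((φ γ').coeff 1)
      exact hl ((hf.weightEq hφ β γ').weight_linear (Int.cast_ne_zero.2 hβ) hd l)
    have hconst : ∀ β γ : ℤ, β ≠ 0 → ∃ a, ∀ l x, evalEval x l (f β γ) = a := by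
      intro β γ' hβ
      by_cases h0 : f β γ' = 0
      · exact ⟨0, fun l x => by rw [h0, evalEval_zero]⟩
      obtain ⟨a, ha⟩ := natDegree_eq_zero.1 (hdeg β γ' hβ)
      refine ⟨a, fun l x => ?_⟩
      by_cases hl : l = 0
      · rw [hl, evalEval_zero_right, ← ha, eval_C]
      · have h1 := hf.weightEq hφ β γ' l 0 x
        have h2 := (hf.weightEq hφ β γ').target_eq h0 l
        rw [h2, evalEval_zero_right, evalEval_zero_right, ← ha, eval_C, eval_C, add_zero] at h1
        refine mul_left_cancel₀ (mul_ne_zero (Int.cast_ne_zero.2 hβ) hl) ?_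
        linear_combination h1
    obtain ⟨a₁, h₁⟩ := hconst (-1) (1 + γ) (by norm_num)
    obtain ⟨a₂, h₂⟩ := hconst 1 γ (by norm_num)
    obtain ⟨a₃, h₃⟩ := hconst 1 (-1 + γ) (by norm_num)
    obtain ⟨a₄, h₄⟩ := hconst (-1) γ (by norm_num)
    have hJ : ∀ l, l * eval l (φ γ) = a₁ * a₂ - a₃ * a₄ := by
      intro l
      have := hf (-1) 1 γ l 0 0
      rw [neg_add_cancel, hφ, h₁, h₂, h₃, h₄] at this
      rw [← this]
      push_cast
      ring_nf
    have hX : X * φ γ = 0 := by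
      refine Polynomial.funext fun l => ?_
      rw [eval_mul, eval_X, eval_zero, hJ, ← hJ 0, zero_mul]
    exact hγ ((mul_eq_zero.1 hX).resolve_left X_ne_zero)
  refine ⟨c₀ - γ₀, fun γ' l x => ?_⟩
  have h1 := hφγ γ' l
  have h2 := hφγ γ₀ l
  rw [hlin] at h2
  rw [hφ, h1]
  linear_combination -h2

/-! ### Normalization of the structure coefficients -/

/-- The action of `L_0` on the component `γ` is multiplication by `(γ + c) λ`. -/
def HasDegree (f : ℤ → ℤ → ℂ[X][X]) (c : ℂ) : Prop :=
  ∀ (γ : ℤ) (l x : ℂ), evalEval x l (f 0 γ) = (γ + c) * l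

theorem HasDegree.weightEq {f : ℤ → ℤ → ℂ[X][X]} {c : ℂ} (hc : HasDegree f c)
    (hf : JacobiCoeffs f) (β γ : ℤ) :
    WeightEq β (C (γ + c) * X) (C (γ + β + c) * X) (f β γ) := by
  have := hf.weightEq (φ := fun γ => C (γ + c) * X) (fun γ l x => by simp [hc γ l x]) β γ
  simpa [add_comm (β : ℂ)] using this

theorem HasDegree.evalEval_eq {f : ℤ → ℤ → ℂ[X][X]} {c : ℂ} (hc : HasDegree f c)
    (hf : JacobiCoeffs f) (β γ : ℤ) (l x : ℂ) :
    β * evalEval x l (f β γ) =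
      (γ + β + c) * eval (x + l) ((f β γ).coeff 0) - (γ + c) * eval x ((f β γ).coeff 0) :=
  (hc.weightEq hf β γ).evalEval_eq (by simp) (by simp) (by ring) l x

theorem HasDegree.exists_eq_linear {f : ℤ → ℤ → ℂ[X][X]} {c : ℂ} (hc : HasDegree f c)
    (hf : JacobiCoeffs f) {β γ : ℤ} (hγ : (γ : ℂ) + c ≠ 0) (hβγ : (γ : ℂ) + β + c ≠ 0) :
    ∃ k d : ℂ, (∀ l x, evalEval x l (f β γ) = k * ((γ + β + c) * l + β * x) + d) ∧
      (β = 0 → k = 1) := by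
  by_cases hβ : β = 0
  · subst hβ
    exact ⟨1, 0, fun l x => by rw [hc]; push_cast; ring, fun _ => rfl⟩
  · obtain ⟨k, d, h⟩ := (hc.weightEq hf β γ).exists_eq_linear (by simp) (by simp) (by ring) hγ hβγ
      (Int.cast_ne_zero.2 hβ)
    exact ⟨k, d, h, fun h0 => absurd h0 hβ⟩

theorem HasDegree.exists_eq_affine {f : ℤ → ℤ → ℂ[X][X]} {c : ℂ} (hc : HasDegree f c)
    (hf : JacobiCoeffs f) {α γ : ℤ} (hγ : (γ : ℂ) + c ≠ 0) :
    ∃ u v : ℂ, ∀ l, evalEval 0 l (f α γ) = u + v * l := by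
  by_cases h : (γ : ℂ) + α + c = 0
  · have hα : (α : ℂ) ≠ 0 := by
      intro h0
      apply hγ
      rwa [h0, add_zero] at h
    refine ⟨eval 0 ((f α γ).coeff 0), 0, fun l => mul_left_cancel₀ hα ?_⟩
    rw [hc.evalEval_eq hf, h]
    linear_combination -(eval 0 ((f α γ).coeff 0)) * h
  · obtain ⟨k, d, hkd, -⟩ := hc.exists_eq_linear hf hγ h
    exact ⟨d, k * (γ + α + c), fun l => by rw [hkd]; ring⟩

/-- The leading coefficients form a cocycle. -/
theorem HasDegree.cocycle {f : ℤ → ℤ → ℂ[X][X]} {c : ℂ} (hc : HasDegree f c)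
    (hf : JacobiCoeffs f) {k d : ℤ → ℤ → ℂ}
    (hkd : ∀ β γ : ℤ, (γ : ℂ) + c ≠ 0 → (γ : ℂ) + β + c ≠ 0 →
      (∀ l x, evalEval x l (f β γ) = k β γ * ((γ + β + c) * l + β * x) + d β γ) ∧
        (β = 0 → k β γ = 1))
    {α β γ : ℤ} (h₁ : (γ : ℂ) + c ≠ 0) (h₂ : (γ : ℂ) + β + c ≠ 0)
    (h₃ : (γ : ℂ) + α + β + c ≠ 0) : k (α + β) γ = k α (β + γ) * k β γ := by
  by_cases hβ : β = 0
  · subst hβ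
    rw [(hkd 0 γ h₁ h₂).2 rfl, add_zero, zero_add, mul_one]
  -- The intermediate component `α + γ` may have degree zero, where the linear form is not
  -- available; being affine in `l` at `x = 0` is enough, since only the coefficient of `l²` is
  -- compared.
  obtain ⟨u, v, huv⟩ := hc.exists_eq_affine hf (α := α) h₁
  have hJ : ∀ l, β * l * (k (α + β) γ * ((γ + (α + β) + c) * l) + d (α + β) γ) =
      (k α (β + γ) * ((γ + (α + β) + c) * l) + d α (β + γ)) * (k β γ * (β * l) + d β γ) -
        evalEval 0 0 (f β (α + γ)) * (u + v * l) := by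
    intro l
    have := hf α β γ l 0 0
    rw [(hkd (α + β) γ h₁ (by push_cast; rwa [← add_assoc])).1,
      (hkd β γ h₁ h₂).1, (hkd α (β + γ) (by push_cast; rwa [add_comm (β : ℂ)])
        (by push_cast; convert h₃ using 1; ring)).1, add_zero (0 : ℂ), huv] at this
    push_cast at this
    linear_combination this
  have hne : (β : ℂ) * (γ + α + β + c) ≠ 0 := mul_ne_zero (Int.cast_ne_zero.2 hβ) h₃
  refine mul_left_cancel₀ hne ?_
  -- The second difference at `-1, 0, 1` isolates the coefficient of `l²`.
  linear_combination (hJ 1 + hJ (-1) - 2 * hJ 0) / 2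

/-- Changing the basis elements by scalars preserves the Jacobi identity. -/
theorem JacobiCoeffs.rescale {f f' : ℤ → ℤ → ℂ[X][X]} (hf : JacobiCoeffs f) {κ : ℤ → ℂ}
    (hκ : ∀ γ, κ γ ≠ 0)
    (h : ∀ (α γ : ℤ) (l x : ℂ), κ (α + γ) * evalEval x l (f α γ) = κ γ * evalEval x l (f' α γ)) :
    JacobiCoeffs f' := by
  intro α β γ l m x
  have h₀ := h (α + β) γ (l + m) x
  have h₁ := h α (β + γ) l x
  have h₂ := h β γ m (x + l)
  have h₃ := h β (α + γ) m x
  have h₄ := h α γ l (x + m)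
  have e₁ : α + (β + γ) = α + β + γ := by ring
  have e₂ : β + (α + γ) = α + β + γ := by ring
  rw [e₁] at h₁
  rw [e₂] at h₃
  have hJ := hf α β γ l m x
  have g₁ : evalEval x l (f α (β + γ)) * evalEval (x + l) m (f β γ) * κ (α + β + γ) =
      κ γ * (evalEval x l (f' α (β + γ)) * evalEval (x + l) m (f' β γ)) := by
    refine mul_left_cancel₀ (hκ (β + γ)) ?_
    linear_combination (κ (β + γ) * evalEval (x + l) m (f β γ)) * h₁ +
      (κ (β + γ) * evalEval x l (f' α (β + γ))) * h₂
  have g₂ : evalEval x m (f β (α + γ)) * evalEval (x + m) l (f α γ) * κ (α + β + γ) =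
      κ γ * (evalEval x m (f' β (α + γ)) * evalEval (x + m) l (f' α γ)) := by
    refine mul_left_cancel₀ (hκ (α + γ)) ?_
    linear_combination (κ (α + γ) * evalEval (x + m) l (f α γ)) * h₃ +
      (κ (α + γ) * evalEval x m (f' β (α + γ))) * h₄
  refine mul_left_cancel₀ (hκ γ) ?_
  linear_combination κ (α + β + γ) * hJ + g₁ - g₂ - (β * l - α * m) * h₀

theorem exists_rescaling {f : ℤ → ℤ → ℂ[X][X]} {κ : ℤ → ℂ} (hκ : ∀ γ, κ γ ≠ 0) :
    ∃ f' : ℤ → ℤ → ℂ[X][X], ∀ (α γ : ℤ) (l x : ℂ),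
      κ (α + γ) * evalEval x l (f α γ) = κ γ * evalEval x l (f' α γ) := by
  refine ⟨fun α γ => C (C (κ (α + γ) / κ γ)) * f α γ, fun α γ l x => ?_⟩
  rw [evalEval_mul, evalEval_CC, ← mul_assoc, mul_div_cancel₀ _ (hκ γ)]

/-- The structure coefficients between components of nonzero degree can be made monic. -/
theorem HasDegree.exists_monic {f : ℤ → ℤ → ℂ[X][X]} {c : ℂ} (hc : HasDegree f c)
    (hf : JacobiCoeffs f) (h1c : (1 : ℂ) + c ≠ 0) :
    ∃ (f' : ℤ → ℤ → ℂ[X][X]) (d : ℤ → ℤ → ℂ), JacobiCoeffs f' ∧ HasDegree f' c ∧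
      ModuleIso (productOfCoeffs f) (productOfCoeffs f') ∧
      ∀ β γ : ℤ, (γ : ℂ) + c ≠ 0 → (γ : ℂ) + β + c ≠ 0 →
        ∀ l x, evalEval x l (f' β γ) = (γ + β + c) * l + β * x + d β γ := by
  have hex : ∀ β γ : ℤ, ∃ k d : ℂ, (γ : ℂ) + c ≠ 0 → (γ : ℂ) + β + c ≠ 0 →
      (∀ l x, evalEval x l (f β γ) = k * ((γ + β + c) * l + β * x) + d) ∧
        (β = 0 → k = 1) := by
    intro β γ
    by_cases h : (γ : ℂ) + c ≠ 0 ∧ (γ : ℂ) + β + c ≠ 0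
    · obtain ⟨k, d, h'⟩ := hc.exists_eq_linear hf h.1 h.2
      exact ⟨k, d, fun _ _ => h'⟩
    · exact ⟨0, 0, fun h₁ h₂ => absurd ⟨h₁, h₂⟩ h⟩
  choose k d hkd using hex
  -- Going from component `1` to `γ` and back multiplies by `k 0 1 = 1`.
  have hk : ∀ γ : ℤ, (γ : ℂ) + c ≠ 0 → k (γ - 1) 1 ≠ 0 := by
    intro γ hγ h0
    have := hc.cocycle hf hkd (α := 1 - γ) (β := γ - 1) (γ := 1) (by simpa using h1c)
      (by push_cast; convert hγ using 1; ring) (by push_cast; convert h1c using 1; ring)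
    rw [h0, mul_zero, show 1 - γ + (γ - 1) = 0 by ring,
      (hkd 0 1 (by simpa using h1c) (by simpa using h1c)).2 rfl] at this
    exact one_ne_zero this
  classical
  -- Component `1` serves as base point, and the cocycle identity turns every rescaled leading
  -- coefficient into `1`. A component of degree zero is subject to no normalisation yet and keeps
  -- its generator.
  let κ : ℤ → ℂ := fun γ => if (γ : ℂ) + c = 0 then 1 else (k (γ - 1) 1)⁻¹
  have hκ : ∀ γ, κ γ ≠ 0 := by
    intro γ
    by_cases h : (γ : ℂ) + c = 0
    · simp [κ, h]
    · simp [κ, h, hk γ h]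
  obtain ⟨f', hf'⟩ := exists_rescaling (f := f) hκ
  refine ⟨f', fun β γ => d β γ / k β γ, hf.rescale hκ hf', fun γ l x => ?_,
    moduleIso_of_coeffs f f' 0 κ hκ (by simpa using hf'), fun β γ hγ hβγ l x => ?_⟩
  · have := hf' 0 γ l x
    rw [zero_add] at this
    rw [← mul_left_cancel₀ (hκ γ) this, hc]
  · have h₁ := hf' β γ l x
    have hβγ' : ((β + γ : ℤ) : ℂ) + c ≠ 0 := by push_cast; rwa [add_comm (β : ℂ)]
    have hcoc : k (β + γ - 1) 1 = k β γ * k (γ - 1) 1 := by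
      have := hc.cocycle hf hkd (α := β) (β := γ - 1) (γ := 1) (by simpa using h1c)
        (by push_cast; convert hγ using 1; ring) (by push_cast; convert hβγ using 1; ring)
      rwa [show β + (γ - 1) = β + γ - 1 by ring, show γ - 1 + 1 = γ by ring] at this
    have hk₁ := hk γ hγ
    have hk₂ : k β γ ≠ 0 := by
      intro h0
      rw [h0, zero_mul] at hcoc
      exact hk _ hβγ' hcoc
    rw [(hkd β γ hγ hβγ).1] at h₁
    simp only [κ, if_neg hγ, if_neg hβγ', hcoc] at h₁
    refine mul_left_cancel₀ (inv_ne_zero hk₁) ?_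
    rw [← h₁]
    field_simp

/-! ### The constant terms -/

/-- Equal sums and products mean that the pairs `{e₁, e₂}` and `{e₃, e₄}` coincide. In either
matching the last relation becomes a nonzero multiple of `e₁ - e₂`. -/
theorem four_eq_of_parallelogram {β c e₁ e₂ e₃ e₄ : ℂ} (hβ : β ≠ 0) (hc : c ≠ 0)
    (hsum : e₁ + e₂ = e₃ + e₄) (hprod : e₁ * e₂ = e₃ * e₄)
    (h : c * e₁ - β * e₂ - (c - β) * e₃ = 0) : e₁ = e₂ ∧ e₁ = e₃ ∧ e₁ = e₄ := by
  have h0 : (e₁ - e₃) * (e₁ - e₄) = 0 := by linear_combination e₁ * hsum - hprod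
  have h1 : e₁ = e₂ := by
    rcases mul_eq_zero.1 h0 with h0 | h0
    · refine mul_left_cancel₀ hβ ?_
      linear_combination h - (c - β) * h0
    · refine mul_left_cancel₀ hc ?_
      linear_combination h - (c - β) * (hsum - h0)
  refine ⟨h1, ?_, ?_⟩
  · rcases mul_eq_zero.1 h0 with h0 | h0
    · exact sub_eq_zero.1 h0
    · linear_combination h1 + (hsum - h0)
  · rcases mul_eq_zero.1 h0 with h0 | h0
    · linear_combination h1 + (hsum - h0)
    · exact sub_eq_zero.1 h0

/-- Propagation of the normalized constant terms `ε` along the graph of all pairs of components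
of nonzero degree. -/
theorem eq_const_of_propagation {c : ℂ} (hreg : ∀ γ : ℤ, γ ≠ 0 → (γ : ℂ) + c ≠ 0)
    {ε : ℤ → ℤ → ℂ}
    (h₁ : ∀ β γ : ℤ, β ≠ 0 → (γ : ℂ) + c ≠ 0 → ((γ + β : ℤ) : ℂ) + c ≠ 0 →
      ((γ - β : ℤ) : ℂ) + c ≠ 0 →
      ε β γ = ε (-β) (γ + β) ∧ ε β γ = ε β (γ - β) ∧ ε β γ = ε (-β) γ)
    (h₂ : ∀ α β γ : ℤ, α ≠ 0 → β ≠ 0 → α + β ≠ 0 → (γ : ℂ) + c ≠ 0 →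
      ((γ + α : ℤ) : ℂ) + c ≠ 0 → ((γ + β : ℤ) : ℂ) + c ≠ 0 →
      ((γ + α + β : ℤ) : ℂ) + c ≠ 0 →
      ((α : ℂ) + β) * ε (α + β) γ =
        (γ + α + β + c) * ε β γ + α * ε α (γ + β) - (γ + α + c) * ε β (γ + α)) :
    ∃ D : ℂ, ∀ β γ : ℤ, β ≠ 0 → (γ : ℂ) + c ≠ 0 → ((γ + β : ℤ) : ℂ) + c ≠ 0 → ε β γ = D := by
  have hne : ∀ s : ℤ, s ≠ 0 → ∀ a : ℕ, s * ((a : ℤ) + 1) ≠ 0 := fun s hs a =>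
    mul_ne_zero hs (by omega)
  -- On the multiples `s, 2s, 3s, …` no component of degree zero is met: `h₁` moves the source along
  -- this ray, and `h₂` then increases the index of the operator.
  have hstep : ∀ s : ℤ, s ≠ 0 → ∀ a : ℕ, ε s (s * (a + 1)) = ε s s := by
    intro s hs a
    induction a with
    | zero => simp
    | succ a ih =>
      have e₁ : s * (((a + 1 : ℕ) : ℤ) + 1) + s = s * ((a + 2 : ℕ) + 1) := by push_cast; ring
      have e₂ : s * (((a + 1 : ℕ) : ℤ) + 1) - s = s * (a + 1) := by push_cast; ring
      have := (h₁ s (s * ((a + 1 : ℕ) + 1)) hs (hreg _ (hne s hs _))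
        (hreg _ (e₁ ▸ hne s hs _)) (hreg _ (e₂ ▸ hne s hs _))).2.1
      rwa [e₂, ih] at this
  have hray : ∀ s : ℤ, s ≠ 0 → ∀ n a : ℕ, ε (s * (n + 1)) (s * (a + 1)) = ε s s := by
    intro s hs n
    induction n with
    | zero => intro a; simpa using hstep s hs a
    | succ n ih =>
      intro a
      have e₁ : s * ((a : ℤ) + 1) + s = s * ((a + 1 : ℕ) + 1) := by push_cast; ring
      have e₂ : s * ((a : ℤ) + 1) + s * (n + 1) = s * ((a + n + 1 : ℕ) + 1) := by push_cast; ring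
      have e₃ : s * ((a : ℤ) + 1) + s * (n + 1) + s = s * ((a + n + 2 : ℕ) + 1) := by
        push_cast; ring
      have e₄ : s * ((n : ℤ) + 1) + s = s * ((n + 1 : ℕ) + 1) := by push_cast; ring
      have := h₂ (s * (n + 1)) s (s * (a + 1)) (hne s hs _) hs (e₄ ▸ hne s hs _)
        (hreg _ (hne s hs _)) (hreg _ (e₂ ▸ hne s hs _)) (hreg _ (e₁ ▸ hne s hs _))
        (hreg _ (e₃ ▸ hne s hs _))
      rw [e₁, e₂, e₄, hstep s hs, hstep s hs, ih] at this
      have hsn : (s : ℂ) * (n + 1 + 1) ≠ 0 :=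
        mul_ne_zero (Int.cast_ne_zero.2 hs) (by exact_mod_cast (n + 1).succ_ne_zero)
      refine mul_left_cancel₀ hsn ?_
      push_cast at this ⊢
      linear_combination this
  have hpos : ∀ β γ : ℤ, 0 < β → 0 < γ → ε β γ = ε 1 1 := by
    intro β γ hβ hγ
    obtain ⟨n, rfl⟩ : ∃ n : ℕ, β = 1 * (n + 1) := ⟨(β - 1).toNat, by omega⟩
    obtain ⟨a, rfl⟩ : ∃ a : ℕ, γ = 1 * (a + 1) := ⟨(γ - 1).toNat, by omega⟩
    exact hray 1 one_ne_zero n a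
  have hneg₀ : ∀ β γ : ℤ, β < 0 → γ < 0 → ε β γ = ε (-1) (-1) := by
    intro β γ hβ hγ
    obtain ⟨n, rfl⟩ : ∃ n : ℕ, β = -1 * (n + 1) := ⟨(-β - 1).toNat, by omega⟩
    obtain ⟨a, rfl⟩ : ∃ a : ℕ, γ = -1 * (a + 1) := ⟨(-γ - 1).toNat, by omega⟩
    exact hray (-1) (by norm_num) n a
  have hr : ∀ β γ : ℤ, β ≠ 0 → γ ≠ 0 → γ + β ≠ 0 → γ - β ≠ 0 →
      ε β γ = ε (-β) (γ + β) ∧ ε β γ = ε β (γ - β) ∧ ε β γ = ε (-β) γ :=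
    fun β γ g g₁ g₂ g₃ => h₁ β γ g (hreg _ g₁) (hreg _ g₂) (hreg _ g₃)
  -- The two rays are joined by jumping over component `0`: `ε 2 1 = ε 2 (-1) = ε (-2) (-1)`.
  have hsgn : ε (-1) (-1) = ε 1 1 := by
    have g₁ := (hr 2 1 (by norm_num) (by norm_num) (by norm_num) (by norm_num)).2.1
    have g₂ := (hr 2 (-1) (by norm_num) (by norm_num) (by norm_num) (by norm_num)).2.2
    norm_num at g₁ g₂
    rw [← hneg₀ (-2) (-1) (by norm_num) (by norm_num), ← g₂, ← g₁, hpos 2 1 (by norm_num)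
      (by norm_num)]
  have hneg : ∀ β γ : ℤ, β < 0 → γ < 0 → ε β γ = ε 1 1 := fun β γ hβ hγ =>
    (hneg₀ β γ hβ hγ).trans hsgn
  have hnz : ∀ β γ : ℤ, β ≠ 0 → γ ≠ 0 → γ + β ≠ 0 → ε β γ = ε 1 1 := by
    intro β γ hβ hγ hβγ
    rcases lt_or_gt_of_ne hγ with hγ' | hγ' <;> rcases lt_or_gt_of_ne hβ with hβ' | hβ'
    · exact hneg β γ hβ' hγ'
    · rw [(hr β γ hβ hγ hβγ (by omega)).2.2]
      exact hneg _ _ (by omega) hγ'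
    · rw [(hr β γ hβ hγ hβγ (by omega)).2.2]
      exact hpos _ _ (by omega) hγ'
    · exact hpos β γ hβ' hγ'
  refine ⟨ε 1 1, fun β γ hβ hγ hβγ => ?_⟩
  -- Pairs that start or end at component `0`, possible only if its degree is nonzero, are shifted
  -- by `β` to pairs already treated.
  by_cases h0 : γ = 0
  · subst h0
    have g := (h₁ β β hβ (hreg _ hβ) (hreg _ (by omega)) (by simpa using hγ)).2.1
    rw [sub_self] at g
    rw [← g]
    exact hnz β β hβ hβ (by omega)
  by_cases h0' : γ + β = 0
  · rw [(h₁ β γ hβ hγ hβγ (hreg _ (by omega))).2.1]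
    exact hnz _ _ hβ (by omega) (by omega)
  exact hnz β γ hβ h0 h0'

/-- The constant terms of monic structure coefficients are `β D`. -/
theorem JacobiCoeffs.exists_constant_term {f : ℤ → ℤ → ℂ[X][X]} (hf : JacobiCoeffs f) {c : ℂ}
    (hreg : ∀ γ : ℤ, γ ≠ 0 → (γ : ℂ) + c ≠ 0) (hc : HasDegree f c) {d : ℤ → ℤ → ℂ}
    (hd : ∀ β γ : ℤ, (γ : ℂ) + c ≠ 0 → (γ : ℂ) + β + c ≠ 0 →
      ∀ l x, evalEval x l (f β γ) = (γ + β + c) * l + β * x + d β γ) :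
    ∃ D : ℂ, ∀ β γ : ℤ, (γ : ℂ) + c ≠ 0 → (γ : ℂ) + β + c ≠ 0 →
      ∀ l x, evalEval x l (f β γ) = (γ + β + c) * l + β * (x + D) := by
  have hJ : ∀ α β γ : ℤ, (γ : ℂ) + c ≠ 0 → (γ : ℂ) + α + c ≠ 0 → (γ : ℂ) + β + c ≠ 0 →
      (γ : ℂ) + α + β + c ≠ 0 → ∀ l m x : ℂ,
      (β * l - α * m) * ((γ + α + β + c) * (l + m) + (α + β) * x + d (α + β) γ) =
      ((γ + α + β + c) * l + α * x + d α (γ + β)) *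
        ((γ + β + c) * m + β * (x + l) + d β γ) -
      ((γ + α + β + c) * m + β * x + d β (γ + α)) *
        ((γ + α + c) * l + α * (x + m) + d α γ) := by
    intro α β γ h₀ h₁ h₂ h₃ l m x
    have := hf α β γ l m x
    rw [add_comm β γ, add_comm α γ, hd (α + β) γ h₀ (by push_cast; rwa [← add_assoc]),
      hd β γ h₀ h₂, hd α γ h₀ h₁, hd α (γ + β) (by push_cast; exact h₂)
      (by push_cast; convert h₃ using 1; ring), hd β (γ + α) (by push_cast; exact h₁)
      (by push_cast; exact h₃)] at this
    push_cast at this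
    linear_combination this
  have hd0 : ∀ γ : ℤ, (γ : ℂ) + c ≠ 0 → d 0 γ = 0 := by
    intro γ hγ
    have := hd 0 γ hγ (by simpa using hγ) 0 0
    rw [hc] at this
    simpa using this.symm
  obtain ⟨ε, hε⟩ : ∃ ε : ℤ → ℤ → ℂ, ∀ β γ : ℤ, (γ : ℂ) + c ≠ 0 → d β γ = β * ε β γ := by
    refine ⟨fun β γ => d β γ / β, fun β γ hγ => ?_⟩
    by_cases hβ : β = 0
    · subst hβ
      simp [hd0 γ hγ]
    · exact (mul_div_cancel₀ _ (Int.cast_ne_zero.2 hβ)).symm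
  obtain ⟨D, hD⟩ : ∃ D : ℂ, ∀ β γ : ℤ, β ≠ 0 → (γ : ℂ) + c ≠ 0 →
      ((γ + β : ℤ) : ℂ) + c ≠ 0 → ε β γ = D := by
    refine eq_const_of_propagation hreg ?_ ?_
    · intro β γ hβ h₀ h₁ h₂
      have hβ' : (β : ℂ) ≠ 0 := Int.cast_ne_zero.2 hβ
      have key := hJ (-β) β γ h₀ (by push_cast at h₂ ⊢; exact h₂) (by push_cast at h₁; exact h₁)
        (by push_cast; convert h₀ using 1; ring)
      rw [neg_add_cancel, hd0 γ h₀, ← sub_eq_add_neg, hε _ _ h₀, hε _ _ h₀, hε _ _ h₁,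
        hε _ _ h₂] at key
      push_cast at key
      -- At `l = m = 0` the identity reads `(x + e₁)(x + e₂) = (x + e₃)(x + e₄)`, giving sum and
      -- product; the part odd in `l` gives the third relation.
      refine four_eq_of_parallelogram hβ' h₀ ?_ ?_ ?_
      · refine mul_left_cancel₀ (mul_ne_zero hβ' hβ') ?_
        linear_combination key 0 0 1 - key 0 0 0
      · refine mul_left_cancel₀ (mul_ne_zero hβ' hβ') ?_
        linear_combination key 0 0 0
      · refine (mul_eq_zero.1 (?_ : (β : ℂ) * _ = 0)).resolve_left hβ'
        linear_combination (key (-1) 0 0 - key 1 0 0) / 2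
    · intro α β γ hα hβ hαβ h₀ h₁ h₂ h₃
      have hβ' : (β : ℂ) ≠ 0 := Int.cast_ne_zero.2 hβ
      have key := hJ α β γ h₀ (by push_cast at h₁; exact h₁) (by push_cast at h₂; exact h₂)
        (by push_cast at h₃; exact h₃)
      rw [hε _ _ h₀, hε _ _ h₀, hε _ _ h₀, hε _ _ h₁, hε _ _ h₂] at key
      push_cast at key
      refine mul_left_cancel₀ hβ' ?_
      linear_combination (key 1 0 0 - key (-1) 0 0) / 2
  refine ⟨D, fun β γ hγ hβγ l x => ?_⟩
  rw [hd β γ hγ hβγ, hε β γ hγ]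
  by_cases hβ : β = 0
  · simp [hβ]
  · rw [hD β γ hβ hγ (by push_cast; exact hβγ)]
    ring

/-! ### The three families -/

/-- The structure coefficients of `V_{c,d}`. -/
noncomputable def coeffsV (c d : ℂ) (α γ : ℤ) : ℂ[X][X] :=
  const (α + γ + c) * lam + const α * (del + const d)

/-- The structure coefficients of `V_d`. -/
noncomputable def coeffsVD (d : ℂ) (α γ : ℤ) : ℂ[X][X] :=
  if γ = 0 then const α * (lam + del + const d) ^ 2
  else if α + γ = 0 then const α
  else const (α + γ) * lam + const α * (del + const d)

/-- The structure coefficients of `V'_d`. -/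
noncomputable def coeffsVDPrime (d : ℂ) (α γ : ℤ) : ℂ[X][X] :=
  if γ = 0 then const α
  else if α + γ = 0 then const α * (del + const d) ^ 2
  else const (α + γ) * lam + const α * (del + const d)

theorem evalEval_coeffsV (c d : ℂ) (α γ : ℤ) (l x : ℂ) :
    evalEval x l (coeffsV c d α γ) = (α + γ + c) * l + α * (x + d) := by
  rw [coeffsV]
  simp only [evalEval_add, evalEval_mul, evalEval_const, evalEval_lam, evalEval_del]

theorem evalEval_coeffsVD (d : ℂ) (α γ : ℤ) (l x : ℂ) :
    evalEval x l (coeffsVD d α γ) = if γ = 0 then α * (l + x + d) ^ 2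
      else if α + γ = 0 then (α : ℂ) else (α + γ) * l + α * (x + d) := by
  rw [coeffsVD]
  split_ifs <;> simp only [evalEval_add, evalEval_mul, evalEval_pow, evalEval_const, evalEval_lam,
    evalEval_del]

theorem evalEval_coeffsVDPrime (d : ℂ) (α γ : ℤ) (l x : ℂ) :
    evalEval x l (coeffsVDPrime d α γ) = if γ = 0 then (α : ℂ)
      else if α + γ = 0 then α * (x + d) ^ 2 else (α + γ) * l + α * (x + d) := by
  rw [coeffsVDPrime]
  split_ifs <;> simp only [evalEval_add, evalEval_mul, evalEval_pow, evalEval_const, evalEval_lam,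
    evalEval_del]

/-! ### The three families are nontrivial modules, and integer shifts of `c`. -/

theorem jacobiCoeffs_coeffsV (c d : ℂ) : JacobiCoeffs (coeffsV c d) := by
  intro α β γ l m x
  simp only [evalEval_coeffsV]
  push_cast
  ring

theorem cast_add_eq_zero {m n : ℤ} (h : m + n = 0) : (m : ℂ) = -n := by
  rw [eq_neg_of_add_eq_zero_left h, Int.cast_neg]

/-- The vanishing of `γ`, `α + γ`, `β + γ` and `α + β + γ` decides which formula applies to each
coefficient. Every consistent case is a polynomial identity modulo the resulting linear relations.
-/
theorem jacobiCoeffs_coeffsVD (d : ℂ) : JacobiCoeffs (coeffsVD d) := by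
  intro α β γ l m x
  have e : β + (α + γ) = α + β + γ := by ring
  simp only [evalEval_coeffsVD, ← add_assoc α β γ, e]
  by_cases h₁ : γ = 0 <;> by_cases h₂ : α + γ = 0 <;> by_cases h₃ : β + γ = 0 <;>
    by_cases h₄ : α + β + γ = 0 <;> simp only [h₁, h₂, h₃, h₄, if_true, if_false] <;>
    try have g₁ : (γ : ℂ) = 0 := by exact_mod_cast h₁
  all_goals try have g₂ := cast_add_eq_zero h₂
  all_goals try have g₃ := cast_add_eq_zero h₃
  all_goals try have g₄ := cast_add_eq_zero h₄
  all_goals push_cast at *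
  all_goals grind

theorem jacobiCoeffs_coeffsVDPrime (d : ℂ) : JacobiCoeffs (coeffsVDPrime d) := by
  intro α β γ l m x
  have e : β + (α + γ) = α + β + γ := by ring
  simp only [evalEval_coeffsVDPrime, ← add_assoc α β γ, e]
  by_cases h₁ : γ = 0 <;> by_cases h₂ : α + γ = 0 <;> by_cases h₃ : β + γ = 0 <;>
    by_cases h₄ : α + β + γ = 0 <;> simp only [h₁, h₂, h₃, h₄, if_true, if_false] <;>
    try have g₁ : (γ : ℂ) = 0 := by exact_mod_cast h₁
  all_goals try have g₂ := cast_add_eq_zero h₂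
  all_goals try have g₃ := cast_add_eq_zero h₃
  all_goals try have g₄ := cast_add_eq_zero h₄
  all_goals push_cast at *
  all_goals grind

/-- Two coefficients are offered because either value may vanish for special parameters; in all
three families the two values differ by `1`. -/
theorem isNontrivial_productOfCoeffs {f : ℤ → ℤ → ℂ[X][X]} (hf : JacobiCoeffs f)
    (h : evalEval 0 1 (f 1 1) ≠ 0 ∨ evalEval 0 1 (f 1 2) ≠ 0) :
    IsNontrivialFreeIntermediateSeries (productOfCoeffs f) := by
  refine ⟨isFreeIntermediateSeries_productOfCoeffs hf, ?_⟩
  rcases h with h | h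
  · exact not_isTrivialAction_productOfCoeffs fun h0 => h (by rw [h0, evalEval_zero])
  · exact not_isTrivialAction_productOfCoeffs fun h0 => h (by rw [h0, evalEval_zero])

theorem isNontrivialFreeIntermediateSeries_actV (c d : ℂ) :
    IsNontrivialFreeIntermediateSeries (actV c d) := by
  refine isNontrivial_productOfCoeffs (f := coeffsV c d) (jacobiCoeffs_coeffsV c d) ?_
  rw [evalEval_coeffsV, evalEval_coeffsV]
  by_contra! h
  push_cast at h
  exact one_ne_zero (α := ℂ) (by linear_combination h.2 - h.1)

theorem isNontrivialFreeIntermediateSeries_actVD (d : ℂ) :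
    IsNontrivialFreeIntermediateSeries (actVD d) := by
  refine isNontrivial_productOfCoeffs (f := coeffsVD d) (jacobiCoeffs_coeffsVD d) ?_
  rw [evalEval_coeffsVD, evalEval_coeffsVD]
  by_contra! h
  norm_num at h
  exact one_ne_zero (α := ℂ) (by linear_combination h.2 - h.1)

theorem isNontrivialFreeIntermediateSeries_actVDPrime (d : ℂ) :
    IsNontrivialFreeIntermediateSeries (actVDPrime d) := by
  refine isNontrivial_productOfCoeffs (f := coeffsVDPrime d) (jacobiCoeffs_coeffsVDPrime d) ?_
  rw [evalEval_coeffsVDPrime, evalEval_coeffsVDPrime]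
  by_contra! h
  norm_num at h
  exact one_ne_zero (α := ℂ) (by linear_combination h.2 - h.1)

theorem moduleIso_actV_add_intCast (c d : ℂ) (n : ℤ) : ModuleIso (actV c d) (actV (c + n) d) := by
  refine moduleIso_of_coeffs (coeffsV c d) (coeffsV (c + n) d) (-n) (fun _ => 1)
    (fun _ => one_ne_zero) fun α γ l x => ?_
  rw [evalEval_coeffsV, evalEval_coeffsV]
  push_cast
  ring

/-! ### Classification -/

/-- After a shift of the grading, at most the component `0` has degree zero. -/
theorem HasDegree.exists_shift {f : ℤ → ℤ → ℂ[X][X]} {c : ℂ} (hc : HasDegree f c)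
    (hf : JacobiCoeffs f) :
    ∃ (f' : ℤ → ℤ → ℂ[X][X]) (c' : ℂ), JacobiCoeffs f' ∧ HasDegree f' c' ∧
      ModuleIso (productOfCoeffs f) (productOfCoeffs f') ∧
      ∀ γ : ℤ, γ ≠ 0 → (γ : ℂ) + c' ≠ 0 := by
  by_cases h : ∃ n : ℤ, c = n
  · obtain ⟨n, rfl⟩ := h
    refine ⟨fun α γ => f α (γ - n), 0, fun α β γ l m x => ?_, fun γ l x => ?_, ?_, fun γ hγ => ?_⟩
    · simp only [add_sub_assoc]
      exact hf α β (γ - n) l m x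
    · rw [hc]
      push_cast
      ring
    · exact moduleIso_of_coeffs _ _ n (fun _ => 1) (fun _ => one_ne_zero)
        (by simp)
    · rw [add_zero]
      exact Int.cast_ne_zero.2 hγ
  · refine ⟨f, c, hf, hc, moduleIso_of_coeffs _ _ 0 (fun _ => 1) (fun _ => one_ne_zero) (by simp),
      fun γ _ hγ' => h ⟨-γ, ?_⟩⟩
    push_cast
    linear_combination hγ'

/-- The structure coefficients at the component `0` of degree zero. -/
theorem JacobiCoeffs.exists_mul_eq_sq {f : ℤ → ℤ → ℂ[X][X]} (hf : JacobiCoeffs f)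
    (hc : HasDegree f 0) {D : ℂ}
    (hD : ∀ β γ : ℤ, γ ≠ 0 → γ + β ≠ 0 → ∀ l x, evalEval x l (f β γ) = (γ + β) * l + β * (x + D)) :
    ∃ p q : ℂ[X], p * q = (X - C (-D)) ^ 2 ∧
      (∀ (β : ℤ) (l x : ℂ), evalEval x l (f β 0) = β * eval (x + l) p) ∧
      (∀ (β : ℤ) (l x : ℂ), evalEval x l (f β (-β)) = β * eval x q) := by
  have hp : ∀ β : ℤ, β ≠ 0 → ∀ l x, evalEval x l (f β 0) = eval (x + l) ((f β 0).coeff 0) := by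
    intro β hβ l x
    refine mul_left_cancel₀ (Int.cast_ne_zero.2 hβ) ?_
    rw [hc.evalEval_eq hf]
    push_cast
    ring
  have hq : ∀ β : ℤ, β ≠ 0 → ∀ l x, evalEval x l (f β (-β)) = eval x ((f β (-β)).coeff 0) := by
    intro β hβ l x
    refine mul_left_cancel₀ (Int.cast_ne_zero.2 hβ) ?_
    rw [hc.evalEval_eq hf]
    push_cast
    ring
  -- At `l = m = 0` the left side of the Jacobi identity vanishes and both products on the right
  -- contain the known factor `x + D`, which can be cancelled.
  have hX : ∀ {r s : ℂ[X]}, (∀ x, (x + D) * eval x r = (x + D) * eval x s) → r = s := by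
    intro r s h
    refine mul_left_cancel₀ (X_add_C_ne_zero D) (Polynomial.funext fun x => ?_)
    simpa using h x
  have hp' : ∀ α β : ℤ, α ≠ 0 → β ≠ 0 → α + β ≠ 0 →
      C (α : ℂ) * (f β 0).coeff 0 = C (β : ℂ) * (f α 0).coeff 0 := by
    intro α β hα hβ hαβ
    refine hX fun x => ?_
    have := hf α β 0 0 0 x
    rw [add_zero β, add_zero α, hD α β hβ (by rwa [add_comm]), hD β α hα hαβ, hp β hβ, hp α hα] at this
    simp only [add_zero, mul_zero, sub_zero, zero_mul, zero_add] at this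
    rw [eval_mul, eval_mul, eval_C, eval_C]
    linear_combination -this
  have hq' : ∀ α β : ℤ, α ≠ 0 → β ≠ 0 → α + β ≠ 0 →
      C (α : ℂ) * (f β (-β)).coeff 0 = C (β : ℂ) * (f α (-α)).coeff 0 := by
    intro α β hα hβ hαβ
    refine hX fun x => ?_
    have := hf α β (-α - β) 0 0 x
    rw [show β + (-α - β) = -α by ring, show α + (-α - β) = -β by ring, hq α hα, hq β hβ,
      hD β (-α - β) (by omega) (by omega), hD α (-α - β) (by omega) (by omega)] at this
    simp only [add_zero, mul_zero, sub_zero, zero_mul, zero_add] at this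
    rw [eval_mul, eval_mul, eval_C, eval_C]
    linear_combination this
  have hext : ∀ g : ℤ → ℂ[X], (∀ α β : ℤ, α ≠ 0 → β ≠ 0 → α + β ≠ 0 →
      C (α : ℂ) * g β = C (β : ℂ) * g α) → ∀ β : ℤ, β ≠ 0 → g β = C (β : ℂ) * g 1 := by
    intro g hg β hβ
    -- The pair `(1, -1)` is excluded by `α + β ≠ 0`, so `-1` is compared with `1` through `2`.
    by_cases h : β = -1
    · subst h
      have h₁ := hg 2 (-1) (by norm_num) (by norm_num) (by norm_num)
      have h₂ := hg 1 2 (by norm_num) (by norm_num) (by norm_num)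
      refine mul_left_cancel₀ (C_ne_zero.2 (two_ne_zero : (2 : ℂ) ≠ 0)) ?_
      simp only [Int.cast_neg, Int.cast_one, Int.cast_ofNat, map_neg, map_one] at h₁ h₂ ⊢
      linear_combination h₁ - h₂
    · simpa using hg 1 β one_ne_zero hβ (by omega)
  have hp₁ := hext (fun β => (f β 0).coeff 0) hp'
  have hq₁ := hext (fun β => (f β (-β)).coeff 0) hq'
  refine ⟨(f 1 0).coeff 0, (f 1 (-1)).coeff 0, Polynomial.funext fun x => ?_,
    fun β l x => ?_, fun β l x => ?_⟩
  · have := hf (-1) 1 1 0 0 x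
    rw [show (1 : ℤ) + 1 = 2 by norm_num, show (-1 : ℤ) + 1 = 0 by norm_num, hp 1 one_ne_zero,
      hD 1 1 (by norm_num) (by norm_num), hD (-1) 2 (by norm_num) (by norm_num),
      show f (-1) 1 = f (-1) (-(-1)) by rw [neg_neg], hq (-1) (by norm_num)] at this
    have h₁ := hq₁ (-1) (by norm_num)
    rw [h₁] at this
    push_cast at this
    simp only [add_zero, mul_zero, sub_zero, zero_mul, zero_add, eval_mul, eval_C] at this
    simp only [eval_mul, eval_pow, eval_sub, eval_X, eval_C]
    linear_combination -this
  · by_cases hβ : β = 0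
    · subst hβ
      rw [hc]
      simp
    · rw [hp β hβ]
      have := hp₁ β hβ
      rw [this, eval_mul, eval_C]
  · by_cases hβ : β = 0
    · subst hβ
      rw [hc]
      simp
    · rw [hq β hβ]
      have := hq₁ β hβ
      rw [this, eval_mul, eval_C]

theorem exists_eq_of_mul_eq_sq {p q : ℂ[X]} {r : ℂ} (h : p * q = (X - C r) ^ 2) :
    ∃ (a : ℂ) (i : ℕ), a ≠ 0 ∧ i ≤ 2 ∧ p = C a * (X - C r) ^ i ∧
      q = C a⁻¹ * (X - C r) ^ (2 - i) := by
  obtain ⟨i, hi, u, hu⟩ := (dvd_prime_pow (prime_X_sub_C r) 2).1 (Dvd.intro q h)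
  obtain ⟨a, ha, hau⟩ := Polynomial.isUnit_iff.1 (u⁻¹).isUnit
  have ha0 : a ≠ 0 := ha.ne_zero
  have hp : p = C a * (X - C r) ^ i := by
    rw [hau, ← hu]
    rw [mul_comm p, ← mul_assoc, Units.inv_mul, one_mul]
  refine ⟨a, i, ha0, hi, hp, ?_⟩
  refine mul_left_cancel₀ (?_ : C a * (X - C r) ^ i ≠ 0) ?_
  · exact mul_ne_zero (C_ne_zero.2 ha0) (pow_ne_zero _ (X_sub_C_ne_zero r))
  · rw [← hp, h, hp, mul_mul_mul_comm, ← C_mul, mul_inv_cancel₀ ha0, C_1, one_mul, ← pow_add,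
      Nat.add_sub_cancel' hi]

theorem JacobiCoeffs.classification {f : ℤ → ℤ → ℂ[X][X]} (hf : JacobiCoeffs f)
    (hne : ∃ α γ, f α γ ≠ 0) :
    (∃ c d : ℂ, ModuleIso (productOfCoeffs f) (actV c d)) ∨
      (∃ d : ℂ, ModuleIso (productOfCoeffs f) (actVD d)) ∨
      (∃ d : ℂ, ModuleIso (productOfCoeffs f) (actVDPrime d)) := by
  obtain ⟨c₀, hc₀⟩ := hf.exists_degree hne
  obtain ⟨f₁, c, hf₁, hc₁, hiso₁, hreg⟩ := HasDegree.exists_shift hc₀ hf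
  obtain ⟨g, d, hg, hc, hiso₂, hd⟩ := hc₁.exists_monic hf₁ (by simpa using hreg 1 one_ne_zero)
  obtain ⟨D, hD⟩ := hg.exists_constant_term hreg hc hd
  have hiso := hiso₁.trans hiso₂
  by_cases hc0 : c = 0
  · subst hc0
    have hD' : ∀ β γ : ℤ, γ ≠ 0 → γ + β ≠ 0 →
        ∀ l x, evalEval x l (g β γ) = (γ + β) * l + β * (x + D) := by
      intro β γ hγ hβγ l x
      rw [hD β γ (hreg γ hγ) (by exact_mod_cast hreg _ hβγ), add_zero]
    obtain ⟨p, q, hpq, hp, hq⟩ := hg.exists_mul_eq_sq hc hD'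
    obtain ⟨a, i, ha, hi, rfl, rfl⟩ := exists_eq_of_mul_eq_sq hpq
    have hgauge : ∀ g' : ℤ → ℤ → ℂ[X][X],
        (∀ β γ : ℤ, γ ≠ 0 → γ + β ≠ 0 →
          ∀ l x, evalEval x l (g' β γ) = (γ + β) * l + β * (x + D)) →
        (∀ (β : ℤ) (l x : ℂ), evalEval x l (g' β 0) = β * (x + l + D) ^ i) →
        (∀ (β : ℤ), β ≠ 0 → ∀ (l x : ℂ), evalEval x l (g' β (-β)) = β * (x + D) ^ (2 - i)) →
        ModuleIso (productOfCoeffs f) (productOfCoeffs g') := by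
      intro g' h₁ h₂ h₃
      -- Multiplying `v_0` by `a` removes the factor `a` from `p` and the factor `a⁻¹` from `q`.
      refine hiso.trans (moduleIso_of_coeffs g g' 0 (fun γ => if γ = 0 then a else 1) ?_ ?_)
      · intro γ
        split_ifs
        exacts [ha, one_ne_zero]
      · intro α γ l x
        rw [add_zero]
        by_cases hγ : γ = 0
        · subst hγ
          rw [hp, h₂, add_zero, if_pos rfl]
          by_cases hα : α = 0
          · simp [hα]
          · rw [if_neg hα]
            simp only [eval_mul, eval_C, eval_pow, eval_sub, eval_X]
            ring
        · by_cases hαγ : α + γ = 0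
          · have hα : α ≠ 0 := by omega
            obtain rfl : γ = -α := by omega
            rw [hq, h₃ α hα, if_pos hαγ, if_neg hγ]
            simp only [eval_mul, eval_C, eval_pow, eval_sub, eval_X]
            field_simp
            ring
          · rw [if_neg hγ, if_neg hαγ, hD' α γ hγ (by omega), h₁ α γ hγ (by omega)]
    interval_cases i
    · refine Or.inr (Or.inr ⟨D, hgauge (coeffsVDPrime D) ?_ ?_ ?_⟩)
      · intro β γ hγ hβγ l x
        rw [evalEval_coeffsVDPrime, if_neg hγ, if_neg (by omega)]
        ring
      · intro β l x
        rw [evalEval_coeffsVDPrime, if_pos rfl]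
        ring
      · intro β hβ l x
        rw [evalEval_coeffsVDPrime, if_neg (by omega), if_pos (by omega)]
    · refine Or.inl ⟨0, D, hgauge (coeffsV 0 D) ?_ ?_ ?_⟩
      · intro β γ hγ hβγ l x
        rw [evalEval_coeffsV]
        ring
      · intro β l x
        rw [evalEval_coeffsV]
        push_cast
        ring
      · intro β hβ l x
        rw [evalEval_coeffsV]
        push_cast
        ring
    · refine Or.inr (Or.inl ⟨D, hgauge (coeffsVD D) ?_ ?_ ?_⟩)
      · intro β γ hγ hβγ l x
        rw [evalEval_coeffsVD, if_neg hγ, if_neg (by omega)]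
        ring
      · intro β l x
        rw [evalEval_coeffsVD, if_pos rfl]
        ring
      · intro β hβ l x
        rw [evalEval_coeffsVD, if_neg (by omega), if_pos (by omega)]
        ring
  · have hreg' : ∀ γ : ℤ, (γ : ℂ) + c ≠ 0 := by
      intro γ
      by_cases hγ : γ = 0
      · subst hγ
        simpa using hc0
      · exact hreg γ hγ
    refine Or.inl ⟨c, D, hiso.trans (moduleIso_of_coeffs g (coeffsV c D) 0 (fun _ => 1)
      (fun _ => one_ne_zero) fun α γ l x => ?_)⟩
    rw [add_zero, hD α γ (hreg' γ) (by exact_mod_cast hreg' (γ + α)), evalEval_coeffsV]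
    ring

end BlockConformal

theorem theorem1p2 :
    (∀ (V : Type*) [AddCommGroup V] [Module ℂ V] [Module ℂ[X] V] [IsScalarTower ℂ ℂ[X] V]
      (act : LambdaProduct B V), IsNontrivialFreeIntermediateSeries act →
        (∃ c d : ℂ, ModuleIso act (actV c d)) ∨
        (∃ d : ℂ, ModuleIso act (actVD d)) ∨
        (∃ d : ℂ, ModuleIso act (actVDPrime d))) ∧
    (∀ c d : ℂ, IsNontrivialFreeIntermediateSeries (actV c d)) ∧
    (∀ d : ℂ, IsNontrivialFreeIntermediateSeries (actVD d)) ∧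
    (∀ d : ℂ, IsNontrivialFreeIntermediateSeries (actVDPrime d)) ∧
    (∀ (c d : ℂ) (n : ℤ), ModuleIso (actV c d) (actV (c + n) d)) := by
  refine ⟨fun V _ _ _ _ act hact => ?_, isNontrivialFreeIntermediateSeries_actV,
    isNontrivialFreeIntermediateSeries_actVD, isNontrivialFreeIntermediateSeries_actVDPrime,
    moduleIso_actV_add_intCast⟩
  obtain ⟨f, hf, hne, hiso⟩ := exists_coeffs hact
  rcases hf.classification hne with ⟨c, d, h⟩ | ⟨d, h⟩ | ⟨d, h⟩
  · exact Or.inl ⟨c, d, hiso.trans h⟩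
  · exact Or.inr (Or.inl ⟨d, hiso.trans h⟩)
  · exact Or.inr (Or.inr ⟨d, hiso.trans h⟩)
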